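/- Let $(\mathcal V,g)$ be a smooth $4$-dimensional time-oriented spacetime of signature $(-,+,+,+)$ with Levi-Civita connection $\nabla$, and let $S\subset\mathcal V$ be a closed (compact, without boundary), connected, smoothly imbedded spacelike surface with first fundamental form $\gamma$. Let the shape tensor of $S$ be $\vec K(X,Y)=-(\nabla_XY)^\perp$, and for a normal vector $\vec n$ put $K_{\vec n}(X,Y)=g(\vec n,\vec K(X,Y))$. Let $\vec H=\mathrm{tr}_\gamma\vec K$ be the mean curvature vector. For future-pointing null normals $\vec\ell,\vec k$ with $g(\vec\ell,\vec k)=-1$ let $\vec G=-(\det K_{\vec k})\,\vec\ell-(\det K_{\vec\ell})\,\vec k$, whose causal orientation does not depend on the choice of $\vec\ell,\vec k$. The surface $S$ is *totally future-trapped* if, at every point, $\vec H$ is timelike and future-pointing and $\vec G$ is timelike and past-pointing. It is *totally marginally future-trapped* if, at every point, $\vec H$ is non-zero, null and future-pointing and $\vec G$ is non-zero, null and past-pointing. By a *hoop* we mean any closed loop in $S$, that is, any periodic regular $C^2$ curve $\mathcal C$ in $S$. Let $\vec v$ be its unit tangent vector, and let $\vec\varkappa(\vec v)=-\nabla_{\vec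 v}\vec v$ and $\vec\kappa(\vec v)=-\nabla^{\gamma}_{\vec v}\vec v$ be its mean curvature vectors in $\mathcal V$ and in $(S,\gamma)$. The hoop is *$S$-outwardly (marginally) future-trapped* if $\vec\varkappa(\vec v)-\vec\kappa(\vec v)$ is timelike (respectively, non-zero and null) and future-pointing along the whole of $\mathcal C$. (a) If $S$ is totally future-trapped, then every hoop through every point of $S$ is $S$-outwardly future-trapped. (b) If $S$ is totally marginally future-trapped, then every hoop through every point of $S$ is $S$-outwardly marginally future-trapped, and these hoops are consistently so: for every $x\in S$ and any two hoops through $x$, their vectors $\vec\varkappa(\vec v)-\vec\kappa(\vec v)$ at $x$ are collinear; moreover the vector $\vec\varkappa(\vec v)-\vec\kappa(\vec v)$ of every hoop is at every point collinear with $\vec H$. -/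

import Mathlib

open scoped Manifold ContDiff Topology Matrix
open Bundle

noncomputable section

namespace TrappedHoop

/-! ### Metrics and their Levi-Civita derivative -/

section Metric

variable {E : Type*} [NormedAddCommGroup E] [NormedSpace ℝ E]
  {M : Type*} [TopologicalSpace M] [ChartedSpace E M]

variable (E M) in
/-- A field of nondegenerate symmetric bilinear forms on the tangent spaces of a manifold
(without boundary) modelled on `E`. -/
structure MetricField where
  /-- The bilinear form on each tangent space. -/
  val : ∀ x : M, TangentSpace 𝓘(ℝ, E) x →L[ℝ] TangentSpace 𝓘(ℝ, E) x →L[ℝ] ℝ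
  symm : ∀ (x : M) (v w : TangentSpace 𝓘(ℝ, E) x), val x v w = val x w v
  nondegenerate : ∀ (x : M) (v : TangentSpace 𝓘(ℝ, E) x), (∀ w, val x v w = 0) → v = 0

namespace MetricField

variable (g : MetricField E M)

/-- The metric at `x` as an algebraic bilinear form. -/
def bilin (x : M) : LinearMap.BilinForm ℝ (TangentSpace 𝓘(ℝ, E) x) :=
  LinearMap.mk₂ ℝ (fun v w => g.val x v w)
    (by intros; simp) (by intros; simp) (by intros; simp) (by intros; simp)

@[simp] theorem bilin_apply (x : M) (v w : TangentSpace 𝓘(ℝ, E) x) :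
    g.bilin x v w = g.val x v w := rfl

theorem bilin_isSymm (x : M) : (g.bilin x).IsSymm := ⟨fun v w => g.symm x v w⟩

theorem bilin_nondegenerate (x : M) : (g.bilin x).Nondegenerate :=
  ⟨fun v hv => g.nondegenerate x v hv,
    fun v hv => g.nondegenerate x v fun w => (g.symm x v w).trans (hv w)⟩

/-- The metric at `x` on the model space: Mathlib identifies `TangentSpace 𝓘(ℝ, E) x` with `E`
through the chart at `x`. -/
def form (x : M) : E →L[ℝ] E →L[ℝ] ℝ := g.val x

theorem form_apply (x : M) (v w : TangentSpace 𝓘(ℝ, E) x) :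
    g.form x (v : E) (w : E) = g.val x v w := rfl

/-- The linear map `E → T_q M ≃ E` which sends a vector of components in the chart at `p` to the
corresponding tangent vector at `q`. -/
def chartFrame [IsManifold 𝓘(ℝ, E) ∞ M] (p q : M) : E →L[ℝ] E :=
  (trivializationAt E (TangentSpace 𝓘(ℝ, E)) p).symmL ℝ q

/-- The components of the metric in the chart at `p`: a field of bilinear forms on `E`,
given on the target of that chart by `y ↦ g_{φ⁻¹ y}(dφ⁻¹ ·, dφ⁻¹ ·)`. -/
def inChart [IsManifold 𝓘(ℝ, E) ∞ M] (g : MetricField E M) (p : M) (y : E) :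
    E →L[ℝ] E →L[ℝ] ℝ :=
  (g.form ((extChartAt 𝓘(ℝ, E) p).symm y)).bilinearComp
    (chartFrame p ((extChartAt 𝓘(ℝ, E) p).symm y)) (chartFrame p ((extChartAt 𝓘(ℝ, E) p).symm y))

set_option synthInstance.maxHeartbeats 400000 in
/-- The Christoffel symbols of the first kind at `p` in the chart at `p`: the linear form
`z ↦ (∂_v g(w, z) + ∂_w g(v, z) - ∂_z g(v, w)) / 2`. -/
def christoffelFirst [IsManifold 𝓘(ℝ, E) ∞ M] (g : MetricField E M) (p : M) (v w : E) :
    Module.Dual ℝ E :=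
  let D : E →L[ℝ] (E →L[ℝ] E →L[ℝ] ℝ) :=
    fderiv ℝ (g.inChart p) (extChartAt 𝓘(ℝ, E) p p)
  { toFun := fun z => (D v w z + D w v z - D z v w) / 2
    map_add' := by intros; simp; ring
    map_smul' := by intros; simp; ring }

/-- The Christoffel symbols of the second kind at `p` in the chart at `p`, obtained by raising
the index of those of the first kind. Mathlib identifies `TangentSpace 𝓘(ℝ, E) p` with `E`
through the chart at `p`, so the values are tangent vectors at `p`. -/
def christoffel [FiniteDimensional ℝ E] [IsManifold 𝓘(ℝ, E) ∞ M] (g : MetricField E M) (p : M)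
    (v w : TangentSpace 𝓘(ℝ, E) p) :
    TangentSpace 𝓘(ℝ, E) p :=
  haveI : FiniteDimensional ℝ (TangentSpace 𝓘(ℝ, E) p) := inferInstanceAs (FiniteDimensional ℝ E)
  ((g.bilin p).toDual (g.bilin_nondegenerate p)).symm
    (show Module.Dual ℝ (TangentSpace 𝓘(ℝ, E) p) from g.christoffelFirst p v w)

end MetricField

variable {E' : Type*} [NormedAddCommGroup E'] [NormedSpace ℝ E']
  {N : Type*} [TopologicalSpace N] [ChartedSpace E' N]

/-- The components, in the chart at `f x`, of a vector field `Z` along a map `f : N → M`. -/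
def components [IsManifold 𝓘(ℝ, E) ∞ M] (f : N → M)
    (Z : ∀ y : N, TangentSpace 𝓘(ℝ, E) (f y)) (x y : N) : E :=
  (trivializationAt E (TangentSpace 𝓘(ℝ, E)) (f x) (⟨f y, Z y⟩ : TangentBundle 𝓘(ℝ, E) M)).2

/-- The Levi-Civita covariant derivative `∇_u Z` of a vector field `Z` along a map `f : N → M`,
at `x` and in the direction `u ∈ T_x N`; in the chart at `f x` it is
`∂_u Z^a + Γ^a_{bc} (∂_u f^b) Z^c`. -/
def covDerivAlong [FiniteDimensional ℝ E] [IsManifold 𝓘(ℝ, E) ∞ M] (g : MetricField E M)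
    (f : N → M) (Z : ∀ y : N, TangentSpace 𝓘(ℝ, E) (f y)) (x : N)
    (u : TangentSpace 𝓘(ℝ, E') x) : TangentSpace 𝓘(ℝ, E) (f x) :=
  (show TangentSpace 𝓘(ℝ, E) (f x) from mvfderiv 𝓘(ℝ, E') (components f Z x) x u)
    + g.christoffel (f x) (mfderiv 𝓘(ℝ, E') 𝓘(ℝ, E) f x u) (Z x)

end Metric

/-! ### Spacetimes -/

/-- The model space of spacetimes. -/
abbrev E4 := EuclideanSpace ℝ (Fin 4)

/-- The model space of surfaces. -/
abbrev E2 := EuclideanSpace ℝ (Fin 2)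

/-- A smooth metric tensor of signature `(-,+,+,+)` together with a time orientation, which is
given by a continuous timelike vector field. -/
structure Spacetime (V : Type*) [TopologicalSpace V] [ChartedSpace E4 V]
    [IsManifold 𝓘(ℝ, E4) ∞ V] extends MetricField E4 V where
  contMDiff : ContMDiff 𝓘(ℝ, E4) (𝓘(ℝ, E4).prod 𝓘(ℝ, E4 →L[ℝ] E4 →L[ℝ] ℝ)) ∞
    (fun x : V => TotalSpace.mk' (E4 →L[ℝ] E4 →L[ℝ] ℝ)
      (E := fun x : V => TangentSpace 𝓘(ℝ, E4) x →L[ℝ] TangentSpace 𝓘(ℝ, E4) x →L[ℝ] ℝ)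
      x (val x))
  signature : ∀ x : V, ∃ b : Module.Basis (Fin 4) ℝ (TangentSpace 𝓘(ℝ, E4) x),
    ∀ i j, val x (b i) (b j) = if i = j then (if i = 0 then -1 else 1) else 0
  /-- The timelike vector field that is declared to be future-pointing. -/
  time : ∀ x : V, TangentSpace 𝓘(ℝ, E4) x
  continuous_time : Continuous fun x : V => (⟨x, time x⟩ : TangentBundle 𝓘(ℝ, E4) V)
  timelike_time : ∀ x : V, val x (time x) (time x) < 0

section Surfaces

variable {V : Type*} [TopologicalSpace V] [ChartedSpace E4 V] [IsManifold 𝓘(ℝ, E4) ∞ V]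

namespace Spacetime

variable (G : Spacetime V) {x : V}

/-- `v` is timelike and future-pointing. -/
def IsFutureTimelike (v : TangentSpace 𝓘(ℝ, E4) x) : Prop :=
  G.val x v v < 0 ∧ G.val x v (G.time x) < 0

/-- `v` is timelike and past-pointing. -/
def IsPastTimelike (v : TangentSpace 𝓘(ℝ, E4) x) : Prop :=
  G.val x v v < 0 ∧ 0 < G.val x v (G.time x)

/-- `v` is (non-zero) null and future-pointing. -/
def IsFutureNull (v : TangentSpace 𝓘(ℝ, E4) x) : Prop :=
  v ≠ 0 ∧ G.val x v v = 0 ∧ G.val x v (G.time x) < 0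

/-- `v` is (non-zero) null and past-pointing. -/
def IsPastNull (v : TangentSpace 𝓘(ℝ, E4) x) : Prop :=
  v ≠ 0 ∧ G.val x v v = 0 ∧ 0 < G.val x v (G.time x)

end Spacetime

/-! ### Spacelike surfaces -/

/-- An imbedding of the surface `S` in the spacetime, with positive-definite first fundamental
form. -/
structure SpacelikeSurface (G : Spacetime V) (S : Type*) [TopologicalSpace S]
    [ChartedSpace E2 S] [IsManifold 𝓘(ℝ, E2) ∞ S] where
  /-- The imbedding. -/
  emb : S → V
  isSmoothEmbedding : Manifold.IsSmoothEmbedding 𝓘(ℝ, E2) 𝓘(ℝ, E4) ∞ emb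
  spacelike : ∀ (x : S) (v : TangentSpace 𝓘(ℝ, E2) x), v ≠ 0 →
    0 < G.val (emb x) (mfderiv 𝓘(ℝ, E2) 𝓘(ℝ, E4) emb x v) (mfderiv 𝓘(ℝ, E2) 𝓘(ℝ, E4) emb x v)

namespace SpacelikeSurface

variable {G : Spacetime V} {S : Type*} [TopologicalSpace S] [ChartedSpace E2 S]
  [IsManifold 𝓘(ℝ, E2) ∞ S] (F : SpacelikeSurface G S)

/-- The differential of the imbedding. -/
def push (x : S) : TangentSpace 𝓘(ℝ, E2) x →L[ℝ] TangentSpace 𝓘(ℝ, E4) (F.emb x) :=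
  mfderiv 𝓘(ℝ, E2) 𝓘(ℝ, E4) F.emb x

/-- The first fundamental form at `x`, as a bilinear form on the model space. -/
def firstForm (x : S) : E2 →L[ℝ] E2 →L[ℝ] ℝ :=
  (G.form (F.emb x)).bilinearComp (show E2 →L[ℝ] E4 from F.push x)
    (show E2 →L[ℝ] E4 from F.push x)

theorem firstForm_apply (x : S) (v w : TangentSpace 𝓘(ℝ, E2) x) :
    F.firstForm x (v : E2) (w : E2) = G.val (F.emb x) (F.push x v) (F.push x w) := rfl

/-- The first fundamental form `γ` of the surface. -/
def firstFundamentalForm : MetricField E2 S where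
  val x := F.firstForm x
  symm x v w := by
    exact G.symm (F.emb x) (F.push x v) (F.push x w)
  nondegenerate x v h := by
    by_contra hv
    exact (F.spacelike x v hv).ne' (h v)

/-- The tangent space of the surface at `x`, as a subspace of the tangent space of the
spacetime. -/
def tangent (x : S) : Submodule ℝ (TangentSpace 𝓘(ℝ, E4) (F.emb x)) :=
  LinearMap.range (F.push x : TangentSpace 𝓘(ℝ, E2) x →ₗ[ℝ] TangentSpace 𝓘(ℝ, E4) (F.emb x))

/-- The normal space of the surface at `x`. -/
def normal (x : S) : Submodule ℝ (TangentSpace 𝓘(ℝ, E4) (F.emb x)) :=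
  (G.bilin (F.emb x)).orthogonal (F.tangent x)

/-- The orthogonal decomposition of the tangent space of the spacetime into tangent and normal
parts. -/
theorem isCompl_normal_tangent (x : S) : IsCompl (F.normal x) (F.tangent x) := by
  have : FiniteDimensional ℝ (TangentSpace 𝓘(ℝ, E4) (F.emb x)) :=
    inferInstanceAs (FiniteDimensional ℝ E4)
  refine (LinearMap.BilinForm.isCompl_orthogonal_of_restrict_nondegenerate
    (G.bilin_isSymm (F.emb x)).isRefl ?_).symm
  have key : ∀ v ∈ F.tangent x, G.val (F.emb x) v v = 0 → v = 0 := by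
    rintro _ ⟨u, rfl⟩ h
    by_contra hu
    have hu' : u ≠ 0 := fun h0 => hu (by simp [h0])
    exact (F.spacelike x u hu').ne' h
  refine ⟨fun v hv => Subtype.ext (key v v.2 (hv v)), fun v hv => Subtype.ext (key v v.2 (hv v))⟩

/-- The orthogonal projection `w ↦ w^⊥` onto the normal space. -/
def normalPart (x : S) : TangentSpace 𝓘(ℝ, E4) (F.emb x) →ₗ[ℝ] TangentSpace 𝓘(ℝ, E4) (F.emb x) :=
  (F.normal x).projection (F.tangent x) (F.isCompl_normal_tangent x)

/-- The shape tensor on vector fields tangent to the surface: `-K(X, Y) = (∇_X Y)^⊥`. -/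
def shapeField (X Y : ∀ x : S, TangentSpace 𝓘(ℝ, E2) x) (x : S) :
    TangentSpace 𝓘(ℝ, E4) (F.emb x) :=
  -F.normalPart x (covDerivAlong G.toMetricField F.emb (fun y => F.push y (Y y)) x (X x))

/-- The shape tensor `K(v, w)` at a point: its value on vector fields extending `v` and `w`
(smoothly near the point; by tensoriality the choice of the extensions does not matter). -/
def shape (x : S) (v w : TangentSpace 𝓘(ℝ, E2) x) : TangentSpace 𝓘(ℝ, E4) (F.emb x) :=
  F.shapeField (FiberBundle.extend E2 v) (FiberBundle.extend E2 w) x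

/-- The second fundamental form `K_n(v, w) = g(n, K(v, w))` relative to `n`. -/
def secondFundamentalForm (x : S) (n : TangentSpace 𝓘(ℝ, E4) (F.emb x))
    (v w : TangentSpace 𝓘(ℝ, E2) x) : ℝ :=
  G.val (F.emb x) n (F.shape x v w)

/-- The coordinate basis of the tangent space of the surface at `x`, in the chart at `x`. -/
def coord (x : S) (i : Fin 2) : TangentSpace 𝓘(ℝ, E2) x :=
  (EuclideanSpace.single i (1 : ℝ) : E2)

/-- The matrix `γ_{ij}` of the first fundamental form. -/
def gram (x : S) : Matrix (Fin 2) (Fin 2) ℝ :=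
  Matrix.of fun i j => F.firstFundamentalForm.val x (coord x i) (coord x j)

/-- The mean curvature vector: the trace `γ^{ij} K_{ij}` of the shape tensor. -/
def meanCurvature (x : S) : TangentSpace 𝓘(ℝ, E4) (F.emb x) :=
  ∑ i, ∑ j, (F.gram x)⁻¹ i j • F.shape x (coord x i) (coord x j)

/-- The determinant of the matrix of the second fundamental form relative to `n` (a density: it
depends on the coordinates through a positive factor). -/
def detSecond (x : S) (n : TangentSpace 𝓘(ℝ, E4) (F.emb x)) : ℝ :=
  (Matrix.of fun i j => F.secondFundamentalForm x n (coord x i) (coord x j)).det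

/-- `l` and `k` are future-pointing null normal vectors at `x` with `g(l, k) = -1`. -/
structure IsNullNormalPair (x : S) (l k : TangentSpace 𝓘(ℝ, E4) (F.emb x)) : Prop where
  left_mem : l ∈ F.normal x
  right_mem : k ∈ F.normal x
  left_null : G.IsFutureNull l
  right_null : G.IsFutureNull k
  normalized : G.val (F.emb x) l k = -1

/-- The vector density `G = -(det K_k) l - (det K_l) k`. -/
def detVector (x : S) (l k : TangentSpace 𝓘(ℝ, E4) (F.emb x)) :
    TangentSpace 𝓘(ℝ, E4) (F.emb x) :=
  -(F.detSecond x k) • l - (F.detSecond x l) • k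

/-- The mean curvature vector is timelike and future-pointing on the whole surface. -/
def IsFutureTrapped : Prop := ∀ x : S, G.IsFutureTimelike (F.meanCurvature x)

/-- The mean curvature vector is non-zero, null and future-pointing on the whole surface. -/
def IsMarginallyFutureTrapped : Prop := ∀ x : S, G.IsFutureNull (F.meanCurvature x)

/-- Future trapped with `G` timelike and past-pointing. The normalized null normals `l`, `k` exist
at every point, and the causal orientation of `G` does not depend on their choice. -/
def IsTotallyFutureTrapped : Prop :=
  F.IsFutureTrapped ∧
    ∀ x : S, ∃ l k, F.IsNullNormalPair x l k ∧ G.IsPastTimelike (F.detVector x l k)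

/-- Marginally future trapped with `G` null and past-pointing. -/
def IsTotallyMarginallyFutureTrapped : Prop :=
  F.IsMarginallyFutureTrapped ∧
    ∀ x : S, ∃ l k, F.IsNullNormalPair x l k ∧ G.IsPastNull (F.detVector x l k)

end SpacelikeSurface

/-! ### Hoops -/

/-- A closed loop in the surface: a periodic regular `C^2` curve. -/
structure ClosedLoop (S : Type*) [TopologicalSpace S] [ChartedSpace E2 S] where
  /-- The parametrized curve. -/
  curve : ℝ → S
  contMDiff : ContMDiff 𝓘(ℝ, ℝ) 𝓘(ℝ, E2) 2 curve
  regular : ∀ t : ℝ, mfderiv 𝓘(ℝ, ℝ) 𝓘(ℝ, E2) curve t (1 : ℝ) ≠ 0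
  periodic : ∃ L : ℝ, 0 < L ∧ Function.Periodic curve L

namespace ClosedLoop

variable {G : Spacetime V} {S : Type*} [TopologicalSpace S] [ChartedSpace E2 S]
  [IsManifold 𝓘(ℝ, E2) ∞ S] (C : ClosedLoop S) (F : SpacelikeSurface G S)

/-- The velocity of the parametrized curve. -/
def velocity (t : ℝ) : TangentSpace 𝓘(ℝ, E2) (C.curve t) :=
  mfderiv 𝓘(ℝ, ℝ) 𝓘(ℝ, E2) C.curve t (1 : ℝ)

/-- The length of the velocity in the first fundamental form. -/
def speed (t : ℝ) : ℝ :=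
  √(F.firstFundamentalForm.val (C.curve t) (C.velocity t) (C.velocity t))

/-- The unit tangent vector `v` of the curve. -/
def unitTangent (t : ℝ) : TangentSpace 𝓘(ℝ, E2) (C.curve t) :=
  (C.speed F t)⁻¹ • C.velocity t

/-- The mean curvature vector of the curve in the surface: `-∇_v v` for the Levi-Civita
connection of the first fundamental form. The direction `1 / speed` on the parameter line is the
one which the curve maps to `v`. -/
def curvatureInSurface (t : ℝ) : TangentSpace 𝓘(ℝ, E2) (C.curve t) :=
  -covDerivAlong F.firstFundamentalForm C.curve (C.unitTangent F) t
    ((C.speed F t)⁻¹ : ℝ)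

/-- The mean curvature vector of the curve in the spacetime: `-∇_v v` for the Levi-Civita
connection of the spacetime. -/
def curvatureInSpacetime (t : ℝ) : TangentSpace 𝓘(ℝ, E4) (F.emb (C.curve t)) :=
  -covDerivAlong G.toMetricField (fun s => F.emb (C.curve s))
    (fun s => F.push (C.curve s) (C.unitTangent F s)) t ((C.speed F t)⁻¹ : ℝ)

/-- The difference of the mean curvature vectors of the curve in the spacetime and in the
surface. -/
def outwardCurvature (t : ℝ) : TangentSpace 𝓘(ℝ, E4) (F.emb (C.curve t)) :=
  C.curvatureInSpacetime F t - F.push (C.curve t) (C.curvatureInSurface F t)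

/-- The curve is `S`-outwardly future trapped. -/
def IsOutwardlyFutureTrapped : Prop :=
  ∀ t : ℝ, G.IsFutureTimelike (C.outwardCurvature F t)

/-- The curve is `S`-outwardly marginally future trapped. -/
def IsOutwardlyMarginallyFutureTrapped : Prop :=
  ∀ t : ℝ, G.IsFutureNull (C.outwardCurvature F t)

/-- The curve passes through `x`. -/
def PassesThrough (x : S) : Prop := ∃ t : ℝ, C.curve t = x

/-- Consistency of two curves at `x`: whenever they are at `x`, the vectors `outwardCurvature` of
both, which lie in the same tangent space, are collinear. -/
def ConsistentAt (C' : ClosedLoop S) (x : S) : Prop :=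
  ∀ t t' : ℝ, C.curve t = x → C'.curve t' = x →
    ∃ a : ℝ, a ≠ 0 ∧ (C'.outwardCurvature F t' : E4) = a • (C.outwardCurvature F t : E4)

/-- The vector `outwardCurvature` is everywhere collinear with the mean curvature vector of the
surface. -/
def IsCollinearWithMeanCurvature : Prop :=
  ∀ t : ℝ, ∃ a : ℝ, a ≠ 0 ∧ C.outwardCurvature F t = a • F.meanCurvature (C.curve t)

end ClosedLoop

end Surfaces

end TrappedHoop

end

open scoped Manifold ContDiff Topology Matrix
open Bundle

noncomputable section

/-! The difference of the two mean curvature vectors of a curve is the shape tensor evaluated on its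
unit tangent, `K(v, v)`. In coordinates both `∇_v v` and `∇^γ_v v` contain the second derivative of
the curve, which cancels; what remains is the second covariant derivative of the imbedding minus its
tangential part. That this tangential part is given by the Christoffel symbols of the first
fundamental form is the Gauss formula, obtained by differentiating the pulled-back metric. This is
`outwardCurvature_eq_shape`, and it turns everything into algebra at one point.

A normal vector expands as `n = -g(k, n) l - g(l, n) k`. Hence `H`, `G` and `K(v, v)` all have the
form `-p l - q k`, where `(p, q)` are respectively the traces, the determinants and the values on
`v` of `K_k` and `K_l`. Such a vector has norm `-2pq`, so its causal character and orientation are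
read off from the signs of `p` and `q`.

If `H` is future timelike and `G` past timelike, then `K_k` and `K_l` both have negative trace and
positive determinant, so they are negative definite and `K(v, v)` is future timelike. In the
marginal case one of the two forms has zero trace and nonnegative determinant, hence vanishes. Its
determinant is then zero, so the other determinant must be positive and the other form negative
definite. Thus `K(v, v)` and `H` are nonzero multiples of the same null normal, which also gives
consistency. -/

namespace TrappedHoop

set_option synthInstance.maxHeartbeats 400000

/-! ### Tangent vectors and differentials in charts -/

section Charts

variable {E : Type*} [NormedAddCommGroup E] [NormedSpace ℝ E]
  {M : Type*} [TopologicalSpace M] [ChartedSpace E M] [IsManifold 𝓘(ℝ, E) ∞ M]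

variable (E) in
/-- The components, in the chart at `p`, of tangent vectors at `q`. -/
def chartCoframe (p q : M) : TangentSpace 𝓘(ℝ, E) q →L[ℝ] E :=
  (trivializationAt E (TangentSpace 𝓘(ℝ, E)) p).continuousLinearMapAt ℝ q

theorem mem_baseSet_iff (p q : M) :
    q ∈ (trivializationAt E (TangentSpace 𝓘(ℝ, E)) p).baseSet ↔
      q ∈ (extChartAt 𝓘(ℝ, E) p).source := by
  simp

theorem chartCoframe_apply {p q : M} (hq : q ∈ (extChartAt 𝓘(ℝ, E) p).source)
    (v : TangentSpace 𝓘(ℝ, E) q) :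
    chartCoframe E p q v = (trivializationAt E (TangentSpace 𝓘(ℝ, E)) p ⟨q, v⟩).2 := by
  have h := (mem_baseSet_iff (E := E) p q).2 hq
  exact congrFun (Trivialization.coe_linearMapAt_of_mem (R := ℝ) _ h) v

theorem chartCoframe_eq_mfderiv {p q : M} (hq : q ∈ (extChartAt 𝓘(ℝ, E) p).source) :
    chartCoframe E p q = mfderiv 𝓘(ℝ, E) 𝓘(ℝ, E) (extChartAt 𝓘(ℝ, E) p) q :=
  TangentBundle.continuousLinearMapAt_trivializationAt (by simpa using hq)

theorem chartCoframe_self (p : M) (v : TangentSpace 𝓘(ℝ, E) p) : chartCoframe E p p v = v := by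
  rw [chartCoframe_eq_mfderiv (mem_extChartAt_source p)]
  exact DFunLike.congr_fun (mfderiv_extChartAt_self (I := 𝓘(ℝ, E)) (x := p)) v

theorem chartCoframe_chartFrame {p q : M} (hq : q ∈ (extChartAt 𝓘(ℝ, E) p).source) (w : E) :
    chartCoframe E p q (show TangentSpace 𝓘(ℝ, E) q from MetricField.chartFrame (E := E) p q w) = w :=
  Trivialization.continuousLinearMapAt_symmL (R := ℝ) _ ((mem_baseSet_iff (E := E) p q).2 hq) w

theorem chartFrame_chartCoframe {p q : M} (hq : q ∈ (extChartAt 𝓘(ℝ, E) p).source)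
    (w : TangentSpace 𝓘(ℝ, E) q) :
    MetricField.chartFrame (E := E) p q (chartCoframe E p q w) = w :=
  Trivialization.symmL_continuousLinearMapAt (R := ℝ) _ ((mem_baseSet_iff (E := E) p q).2 hq) w

/-- The extensions used to define the shape tensor have constant components in the chart at `p`, so
differentiating them contributes nothing. -/
theorem chartCoframe_extend {p q : M} (hq : q ∈ (extChartAt 𝓘(ℝ, E) p).source)
    (v : TangentSpace 𝓘(ℝ, E) p) :
    chartCoframe E p q (FiberBundle.extend E v q) = v := by
  have h := (mem_baseSet_iff (E := E) p q).2 hq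
  have h1 : (trivializationAt E (TangentSpace 𝓘(ℝ, E)) p ⟨p, v⟩).2 = v := by
    rw [← chartCoframe_apply (mem_extChartAt_source p), chartCoframe_self]
  rw [chartCoframe_apply hq]
  change (trivializationAt E (TangentSpace 𝓘(ℝ, E)) p ⟨q, (trivializationAt E
    (TangentSpace 𝓘(ℝ, E)) p).symm q (trivializationAt E (TangentSpace 𝓘(ℝ, E)) p ⟨p, v⟩).2⟩).2 = v
  rw [h1]
  exact congrArg Prod.snd (Trivialization.apply_mk_symm _ h (v : E))

variable {E' : Type*} [NormedAddCommGroup E'] [NormedSpace ℝ E']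
  {N : Type*} [TopologicalSpace N] [ChartedSpace E' N] [IsManifold 𝓘(ℝ, E') ∞ N]

variable (E E') in
/-- The local representative of a map between manifolds in the charts at `x` and `f x`. -/
def localRep (f : N → M) (x : N) : E' → E :=
  extChartAt 𝓘(ℝ, E) (f x) ∘ f ∘ (extChartAt 𝓘(ℝ, E') x).symm

omit [IsManifold 𝓘(ℝ, E) ∞ M] [IsManifold 𝓘(ℝ, E') ∞ N] in
theorem localRep_self (f : N → M) (x : N) :
    localRep E E' f x (extChartAt 𝓘(ℝ, E') x x) = extChartAt 𝓘(ℝ, E) (f x) (f x) := by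
  simp [localRep]

omit [IsManifold 𝓘(ℝ, E) ∞ M] [IsManifold 𝓘(ℝ, E') ∞ N] in
theorem contDiffAt_localRep {n : WithTop ℕ∞} {f : N → M} (x : N)
    (hf : ContMDiffAt 𝓘(ℝ, E') 𝓘(ℝ, E) n f x) :
    ContDiffAt ℝ n (localRep E E' f x) (extChartAt 𝓘(ℝ, E') x x) := by
  have := (contMDiffAt_iff.1 hf).2
  rwa [modelWithCornersSelf_coe, Set.range_id, contDiffWithinAt_univ] at this

/-- Chain rule for the two factorizations of `f` read in charts. It is needed at every `y` near `x`,
not only at `x`, because the resulting components are differentiated later. -/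
theorem chartCoframe_mfderiv {f : N → M} {x y : N}
    (hy : y ∈ (extChartAt 𝓘(ℝ, E') x).source) (hfy : f y ∈ (extChartAt 𝓘(ℝ, E) (f x)).source)
    (hf : MDifferentiableAt 𝓘(ℝ, E') 𝓘(ℝ, E) f y) (v : TangentSpace 𝓘(ℝ, E') y) :
    chartCoframe E (f x) (f y) (mfderiv 𝓘(ℝ, E') 𝓘(ℝ, E) f y v) =
      fderiv ℝ (localRep E E' f x) (extChartAt 𝓘(ℝ, E') x y) (chartCoframe E' x y v) := by
  have h1 : HasMFDerivAt 𝓘(ℝ, E') 𝓘(ℝ, E) (extChartAt 𝓘(ℝ, E) (f x) ∘ f) y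
      ((mfderiv 𝓘(ℝ, E) 𝓘(ℝ, E) (extChartAt 𝓘(ℝ, E) (f x)) (f y)).comp
        (mfderiv 𝓘(ℝ, E') 𝓘(ℝ, E) f y)) :=
    (mdifferentiableAt_extChartAt (by simpa using hfy)).hasMFDerivAt.comp y hf.hasMFDerivAt
  have hsymm : MDifferentiableAt 𝓘(ℝ, E') 𝓘(ℝ, E') (extChartAt 𝓘(ℝ, E') x).symm
      (extChartAt 𝓘(ℝ, E') x y) := by
    have := mdifferentiableWithinAt_extChartAt_symm (I := 𝓘(ℝ, E'))
      ((extChartAt 𝓘(ℝ, E') x).map_source hy)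
    simpa [mdifferentiableWithinAt_univ] using this
  have hl : DifferentiableAt ℝ (localRep E E' f x) (extChartAt 𝓘(ℝ, E') x y) := by
    rw [← mdifferentiableAt_iff_differentiableAt]
    refine MDifferentiableAt.comp (I' := 𝓘(ℝ, E)) (extChartAt 𝓘(ℝ, E') x y)
      (g := extChartAt 𝓘(ℝ, E) (f x)) ?_ ?_
    · simp only [Function.comp_apply, (extChartAt 𝓘(ℝ, E') x).left_inv hy]
      exact mdifferentiableAt_extChartAt (by simpa using hfy)
    · refine MDifferentiableAt.comp (I' := 𝓘(ℝ, E')) (extChartAt 𝓘(ℝ, E') x y) ?_ hsymm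
      simpa only [(extChartAt 𝓘(ℝ, E') x).left_inv hy] using hf
  have h2 : HasMFDerivAt 𝓘(ℝ, E') 𝓘(ℝ, E) (localRep E E' f x ∘ extChartAt 𝓘(ℝ, E') x) y
      ((fderiv ℝ (localRep E E' f x) (extChartAt 𝓘(ℝ, E') x y)).comp
        (mfderiv 𝓘(ℝ, E') 𝓘(ℝ, E') (extChartAt 𝓘(ℝ, E') x) y)) :=
    hl.hasFDerivAt.hasMFDerivAt.comp y
      (mdifferentiableAt_extChartAt (by simpa using hy)).hasMFDerivAt
  have h3 : localRep E E' f x ∘ extChartAt 𝓘(ℝ, E') x =ᶠ[𝓝 y] extChartAt 𝓘(ℝ, E) (f x) ∘ f := by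
    filter_upwards [(isOpen_extChartAt_source (I := 𝓘(ℝ, E')) x).mem_nhds hy] with z hz
    simp only [localRep, Function.comp_apply, (extChartAt 𝓘(ℝ, E') x).left_inv hz]
  have h4 := hasMFDerivAt_unique h1 (h2.congr_of_eventuallyEq h3.symm)
  rw [chartCoframe_eq_mfderiv hfy, chartCoframe_eq_mfderiv hy]
  exact DFunLike.congr_fun h4 v

theorem mfderiv_eq_fderiv_localRep {f : N → M} {x : N}
    (hf : MDifferentiableAt 𝓘(ℝ, E') 𝓘(ℝ, E) f x) (v : TangentSpace 𝓘(ℝ, E') x) :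
    mfderiv 𝓘(ℝ, E') 𝓘(ℝ, E) f x v =
      fderiv ℝ (localRep E E' f x) (extChartAt 𝓘(ℝ, E') x x) v := by
  have := chartCoframe_mfderiv (mem_extChartAt_source x) (mem_extChartAt_source (f x)) hf v
  rwa [chartCoframe_self, chartCoframe_self] at this

end Charts

/-! ### Metric components and Christoffel symbols -/

theorem fderiv_apply_apply {E F F' : Type*} [NormedAddCommGroup E] [NormedSpace ℝ E]
    [NormedAddCommGroup F] [NormedSpace ℝ F] [NormedAddCommGroup F'] [NormedSpace ℝ F']
    {h : E → F →L[ℝ] F' →L[ℝ] ℝ} {y : E} (hh : DifferentiableAt ℝ h y) (z : E) (a : F) (b : F') :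
    fderiv ℝ h y z a b = fderiv ℝ (fun x => h x a b) y z := by
  have h1 := (hh.hasFDerivAt.clm_apply (hasFDerivAt_const a y)).clm_apply (hasFDerivAt_const b y)
  rw [h1.fderiv]
  simp

namespace MetricField

section InChart

variable {E : Type*} [NormedAddCommGroup E] [NormedSpace ℝ E]
  {M : Type*} [TopologicalSpace M] [ChartedSpace E M] [IsManifold 𝓘(ℝ, E) ∞ M]
  (g : MetricField E M)

theorem inChart_extChartAt {p x : M} (hx : x ∈ (extChartAt 𝓘(ℝ, E) p).source) (v w : E) :
    g.inChart p (extChartAt 𝓘(ℝ, E) p x) v w =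
      g.form x (chartFrame p x v) (chartFrame p x w) := by
  simp only [inChart, (extChartAt 𝓘(ℝ, E) p).left_inv hx]
  rfl

theorem val_eq_inChart {p x : M} (hx : x ∈ (extChartAt 𝓘(ℝ, E) p).source)
    (v w : TangentSpace 𝓘(ℝ, E) x) :
    g.val x v w =
      g.inChart p (extChartAt 𝓘(ℝ, E) p x) (chartCoframe E p x v) (chartCoframe E p x w) := by
  rw [g.inChart_extChartAt hx, chartFrame_chartCoframe hx, chartFrame_chartCoframe hx]
  rfl

theorem inChart_self (p : M) (v w : TangentSpace 𝓘(ℝ, E) p) :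
    g.inChart p (extChartAt 𝓘(ℝ, E) p p) v w = g.val p v w := by
  rw [g.val_eq_inChart (mem_extChartAt_source p), chartCoframe_self, chartCoframe_self]

theorem inChart_symm (p : M) (y : E) (v w : E) : g.inChart p y v w = g.inChart p y w v :=
  g.symm ((extChartAt 𝓘(ℝ, E) p).symm y) (chartFrame (E := E) p ((extChartAt 𝓘(ℝ, E) p).symm y) v)
    (chartFrame (E := E) p ((extChartAt 𝓘(ℝ, E) p).symm y) w)

theorem christoffelFirst_apply (p : M) (v w z : E) :
    g.christoffelFirst p v w z =
      (fderiv ℝ (g.inChart p) (extChartAt 𝓘(ℝ, E) p p) v w z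
        + fderiv ℝ (g.inChart p) (extChartAt 𝓘(ℝ, E) p p) w v z
        - fderiv ℝ (g.inChart p) (extChartAt 𝓘(ℝ, E) p p) z v w) / 2 :=
  rfl

theorem val_christoffel [FiniteDimensional ℝ E] (p : M) (v w z : TangentSpace 𝓘(ℝ, E) p) :
    g.val p (g.christoffel p v w) z = g.christoffelFirst p v w z := by
  have : FiniteDimensional ℝ (TangentSpace 𝓘(ℝ, E) p) := ‹FiniteDimensional ℝ E›
  exact LinearMap.BilinForm.apply_toDual_symm_apply (hB := g.bilin_nondegenerate p)
    (show Module.Dual ℝ (TangentSpace 𝓘(ℝ, E) p) from g.christoffelFirst p v w) z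

theorem fderiv_inChart_symm {p : M}
    (h : DifferentiableAt ℝ (g.inChart p) (extChartAt 𝓘(ℝ, E) p p)) (z v w : E) :
    fderiv ℝ (g.inChart p) (extChartAt 𝓘(ℝ, E) p p) z v w =
      fderiv ℝ (g.inChart p) (extChartAt 𝓘(ℝ, E) p p) z w v := by
  rw [fderiv_apply_apply h, fderiv_apply_apply h]
  simp only [g.inChart_symm p _ v w]

/-- Torsion-freeness: the first two terms are exchanged, and the third inherits the symmetry of the
metric. -/
theorem christoffelFirst_symm {p : M}
    (h : DifferentiableAt ℝ (g.inChart p) (extChartAt 𝓘(ℝ, E) p p)) (v w z : E) :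
    g.christoffelFirst p v w z = g.christoffelFirst p w v z := by
  rw [christoffelFirst_apply, christoffelFirst_apply, g.fderiv_inChart_symm h z v w]
  ring

theorem christoffelFirst_add_left (p : M) (v v' w z : E) :
    g.christoffelFirst p (v + v') w z =
      g.christoffelFirst p v w z + g.christoffelFirst p v' w z := by
  simp only [christoffelFirst_apply, ContinuousLinearMap.map_add, _root_.add_apply]
  ring

theorem christoffelFirst_smul_left (p : M) (a : ℝ) (v w z : E) :
    g.christoffelFirst p (a • v) w z = a * g.christoffelFirst p v w z := by
  simp only [christoffelFirst_apply, ContinuousLinearMap.map_smul, _root_.smul_apply, smul_eq_mul]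
  ring

end InChart

end MetricField

open MetricField in
-- Smoothness of the metric as a section of the bundle of bilinear forms is smoothness of its
-- expression in trivializations; near the base point that expression, composed with the inverse
-- chart, is `inChart`.
theorem Spacetime.contDiffAt_inChart {V : Type*} [TopologicalSpace V] [ChartedSpace E4 V]
    [IsManifold 𝓘(ℝ, E4) ∞ V] (G : Spacetime V) (q : V) :
    ContDiffAt ℝ ∞ (G.inChart q) (extChartAt 𝓘(ℝ, E4) q q) := by
  have h1 := ((contMDiffAt_hom_bundle _).1 (G.contMDiff q)).2
  have h2 : ContMDiffAt 𝓘(ℝ, E4) 𝓘(ℝ, E4) ∞ (extChartAt 𝓘(ℝ, E4) q).symm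
      (extChartAt 𝓘(ℝ, E4) q q) :=
    (contMDiffOn_extChartAt_symm q).contMDiffAt (extChartAt_target_mem_nhds q)
  have h3 : ContDiffAt ℝ ∞ ((fun x => ContinuousLinearMap.inCoordinates E4
      (TangentSpace 𝓘(ℝ, E4)) (E4 →L[ℝ] ℝ) (fun b => TangentSpace 𝓘(ℝ, E4) b →L[ℝ] ℝ)
      q x q x (G.val x)) ∘ (extChartAt 𝓘(ℝ, E4) q).symm) (extChartAt 𝓘(ℝ, E4) q q) := by
    refine (ContMDiffAt.comp (I' := 𝓘(ℝ, E4)) (extChartAt 𝓘(ℝ, E4) q q) ?_ h2).contDiffAt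
    rw [(extChartAt 𝓘(ℝ, E4) q).left_inv (mem_extChartAt_source q)]
    exact h1
  refine h3.congr_of_eventuallyEq ?_
  filter_upwards [extChartAt_target_mem_nhds (I := 𝓘(ℝ, E4)) q] with y hy
  have hs := (mem_baseSet_iff (E := E4) q _).2 ((extChartAt 𝓘(ℝ, E4) q).map_target hy)
  ext v w
  refine Eq.trans ?_ (inCoordinates_apply_eq₂ hs hs (Set.mem_univ _)).symm
  have hid : (trivializationAt ℝ (fun _ : V => ℝ) q).linearMapAt ℝ
      ((extChartAt 𝓘(ℝ, E4) q).symm y) = LinearMap.id :=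
    Bundle.Trivial.linearMapAt_trivialization ℝ V ℝ _
  have hframe : ∀ u : E4, chartFrame q ((extChartAt 𝓘(ℝ, E4) q).symm y) u =
      (trivializationAt E4 (TangentSpace 𝓘(ℝ, E4)) q).symm ((extChartAt 𝓘(ℝ, E4) q).symm y) u :=
    fun u => Trivialization.symmL_apply (R := ℝ) _ hs u
  rw [hid, ← hframe, ← hframe]
  rfl

/-! ### Differentiating a pulled-back metric -/

section Pullback

variable {E F : Type*} [NormedAddCommGroup E] [NormedSpace ℝ E]
  [NormedAddCommGroup F] [NormedSpace ℝ F]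

theorem fderiv_bilinear_apply {h : E → F →L[ℝ] F →L[ℝ] ℝ} {a b : E → F} {y : E}
    {a' b' : E →L[ℝ] F} (hh : DifferentiableAt ℝ h y) (ha : HasFDerivAt a a' y)
    (hb : HasFDerivAt b b' y) (z : E) :
    fderiv ℝ (fun x => h x (a x) (b x)) y z =
      fderiv ℝ h y z (a y) (b y) + h y (a' z) (b y) + h y (a y) (b' z) := by
  have h1 := (hh.hasFDerivAt.clm_apply ha).clm_apply hb
  rw [HasFDerivAt.fderiv (f := fun x => h x (a x) (b x)) h1]
  simp
  ring

theorem clm_comp_differentiableAt {X Y : Type*} [NormedAddCommGroup X] [NormedSpace ℝ X]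
    [NormedAddCommGroup Y] [NormedSpace ℝ Y] (L : X →L[ℝ] Y) {u : E → X} {y : E}
    (hu : DifferentiableAt ℝ u y) : DifferentiableAt ℝ (fun x => L (u x)) y :=
  L.differentiableAt.comp y hu

theorem differentiableAt_bilinearComp {h : E → F →L[ℝ] F →L[ℝ] ℝ} {A : E → E →L[ℝ] F} {y : E}
    (hh : DifferentiableAt ℝ h y) (hA : DifferentiableAt ℝ A y) :
    DifferentiableAt ℝ (fun x => (h x).bilinearComp (A x) (A x)) y := by
  have h0 : DifferentiableAt ℝ (fun x => (h x).comp (A x)) y :=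
    DifferentiableAt.clm_comp (G := F) (H := F →L[ℝ] ℝ) hh hA
  -- Composition acts on the first slot only, so the second slot is reached by flipping; a last flip
  -- restores the order.
  have h1 : DifferentiableAt ℝ (fun x => ((h x).comp (A x)).flip) y :=
    clm_comp_differentiableAt (X := E →L[ℝ] F →L[ℝ] ℝ) (Y := F →L[ℝ] E →L[ℝ] ℝ)
      (ContinuousLinearMap.flipₗᵢ ℝ E F ℝ).toContinuousLinearEquiv.toContinuousLinearMap h0
  have h2 : DifferentiableAt ℝ (fun x => ((h x).comp (A x)).flip.comp (A x)) y :=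
    DifferentiableAt.clm_comp (G := F) (H := E →L[ℝ] ℝ) h1 hA
  exact clm_comp_differentiableAt (X := E →L[ℝ] E →L[ℝ] ℝ) (Y := E →L[ℝ] E →L[ℝ] ℝ)
      (ContinuousLinearMap.flipₗᵢ ℝ E E ℝ).toContinuousLinearEquiv.toContinuousLinearMap h2

theorem hasFDerivAt_fderiv_apply {f : E → F} {y : E} (hf' : DifferentiableAt ℝ (fderiv ℝ f) y)
    (c : E) : HasFDerivAt (fun x => fderiv ℝ f x c) ((fderiv ℝ (fderiv ℝ f) y).flip c) y := by
  simpa using hf'.hasFDerivAt.clm_apply (hasFDerivAt_const c y)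

/-- The derivative of the components of the pullback of a metric. -/
theorem fderiv_pullback_apply {h : F → F →L[ℝ] F →L[ℝ] ℝ} {f : E → F} {y : E}
    (hh : DifferentiableAt ℝ h (f y)) (hf : DifferentiableAt ℝ f y)
    (hf' : DifferentiableAt ℝ (fderiv ℝ f) y) (z a b : E) :
    fderiv ℝ (fun x => (h (f x)).bilinearComp (fderiv ℝ f x) (fderiv ℝ f x)) y z a b =
      fderiv ℝ h (f y) (fderiv ℝ f y z) (fderiv ℝ f y a) (fderiv ℝ f y b)
        + h (f y) (fderiv ℝ (fderiv ℝ f) y z a) (fderiv ℝ f y b)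
        + h (f y) (fderiv ℝ f y a) (fderiv ℝ (fderiv ℝ f) y z b) := by
  have hhf : HasFDerivAt (h ∘ f) ((fderiv ℝ h (f y)).comp (fderiv ℝ f y)) y :=
    HasFDerivAt.comp (G := F →L[ℝ] F →L[ℝ] ℝ) y hh.hasFDerivAt hf.hasFDerivAt
  have hd : DifferentiableAt ℝ (fun x => h (f x)) y := hhf.differentiableAt
  rw [fderiv_apply_apply (differentiableAt_bilinearComp hd hf')]
  change fderiv ℝ (fun x => h (f x) (fderiv ℝ f x a) (fderiv ℝ f x b)) y z = _
  rw [fderiv_bilinear_apply hd (hasFDerivAt_fderiv_apply hf' a) (hasFDerivAt_fderiv_apply hf' b)]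
  have h2 : fderiv ℝ (fun x => h (f x)) y z = fderiv ℝ h (f y) (fderiv ℝ f y z) :=
    DFunLike.congr_fun hhf.fderiv z
  rw [h2]
  rfl

end Pullback

/-! ### Derivatives of vector fields along a map -/

section Components

variable {E : Type*} [NormedAddCommGroup E] [NormedSpace ℝ E]
  {M : Type*} [TopologicalSpace M] [ChartedSpace E M] [IsManifold 𝓘(ℝ, E) ∞ M]
  {E' : Type*} [NormedAddCommGroup E'] [NormedSpace ℝ E']
  {N : Type*} [TopologicalSpace N] [ChartedSpace E' N] [IsManifold 𝓘(ℝ, E') ∞ N]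

omit [TopologicalSpace N] in
theorem components_eq_chartCoframe {f : N → M} {Z : ∀ y : N, TangentSpace 𝓘(ℝ, E) (f y)}
    {x y : N} (hy : f y ∈ (extChartAt 𝓘(ℝ, E) (f x)).source) :
    components f Z x y = chartCoframe E (f x) (f y) (Z y) :=
  (chartCoframe_apply hy _).symm

/-- The chart at `x` has identity differential at `x`, so the intrinsic derivative is that of the
coordinate expression. -/
theorem mvfderiv_of_eventuallyEq {u : N → E} {h : E' → E} {h' : E' →L[ℝ] E} {x : N}
    (hu : u =ᶠ[𝓝 x] h ∘ extChartAt 𝓘(ℝ, E') x)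
    (hh : HasFDerivAt h h' (extChartAt 𝓘(ℝ, E') x x)) (v : TangentSpace 𝓘(ℝ, E') x) :
    mvfderiv 𝓘(ℝ, E') u x v = h' v := by
  have h1 : HasMFDerivAt 𝓘(ℝ, E') 𝓘(ℝ, E) (h ∘ extChartAt 𝓘(ℝ, E') x) x
      (h'.comp (mfderiv 𝓘(ℝ, E') 𝓘(ℝ, E') (extChartAt 𝓘(ℝ, E') x) x)) :=
    hh.hasMFDerivAt.comp x
      (mdifferentiableAt_extChartAt (mem_chart_source E' x)).hasMFDerivAt
  have h2 := (h1.congr_of_eventuallyEq hu).mfderiv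
  have h3 : mvfderiv 𝓘(ℝ, E') u x v = mfderiv 𝓘(ℝ, E') 𝓘(ℝ, E) u x v := rfl
  rw [h3, h2]
  change h' (mfderiv 𝓘(ℝ, E') 𝓘(ℝ, E') (extChartAt 𝓘(ℝ, E') x) x v) = _
  rw [mfderiv_extChartAt_self]
  rfl

end Components

/-! ### The imbedding in coordinates and the Gauss formula -/

section Surfaces

variable {V : Type*} [TopologicalSpace V] [ChartedSpace E4 V] [IsManifold 𝓘(ℝ, E4) ∞ V]
  {G : Spacetime V} {S : Type*} [TopologicalSpace S] [ChartedSpace E2 S]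
  [IsManifold 𝓘(ℝ, E2) ∞ S]

namespace SpacelikeSurface

variable (F : SpacelikeSurface G S)

/-- The imbedding in the charts at `x` and at its image. -/
def rep (x : S) : E2 → E4 := localRep E4 E2 F.emb x

/-- The differential at `x` of the imbedding in coordinates. -/
def jac (x : S) : E2 →L[ℝ] E4 := fderiv ℝ (F.rep x) (extChartAt 𝓘(ℝ, E2) x x)

/-- The second derivative at `x` of the imbedding in coordinates. -/
def hess (x : S) : E2 →L[ℝ] E2 →L[ℝ] E4 :=
  fderiv ℝ (fderiv ℝ (F.rep x)) (extChartAt 𝓘(ℝ, E2) x x)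

theorem mdifferentiableAt_emb (x : S) : MDifferentiableAt 𝓘(ℝ, E2) 𝓘(ℝ, E4) F.emb x :=
  (F.isSmoothEmbedding.contMDiff x).mdifferentiableAt (by simp)

theorem contDiffAt_rep (x : S) : ContDiffAt ℝ ∞ (F.rep x) (extChartAt 𝓘(ℝ, E2) x x) :=
  contDiffAt_localRep x (F.isSmoothEmbedding.contMDiff x)

theorem rep_self (x : S) :
    F.rep x (extChartAt 𝓘(ℝ, E2) x x) = extChartAt 𝓘(ℝ, E4) (F.emb x) (F.emb x) :=
  localRep_self F.emb x

theorem contDiffAt_two_rep (x : S) : ContDiffAt ℝ 2 (F.rep x) (extChartAt 𝓘(ℝ, E2) x x) :=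
  (F.contDiffAt_rep x).of_le (WithTop.coe_le_coe.2 (le_top (a := (2 : ℕ∞))))

theorem differentiableAt_fderiv_rep (x : S) :
    DifferentiableAt ℝ (fderiv ℝ (F.rep x)) (extChartAt 𝓘(ℝ, E2) x x) :=
  ((F.contDiffAt_two_rep x).fderiv_right (m := 1) (by norm_num)).differentiableAt
    one_ne_zero

theorem hess_symm (x : S) (v w : E2) : F.hess x v w = F.hess x w v :=
  ((F.contDiffAt_two_rep x).isSymmSndFDerivAt (by simp)) v w

theorem eventually_mem_source (x : S) : ∀ᶠ y in 𝓝 x, y ∈ (extChartAt 𝓘(ℝ, E2) x).source ∧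
    F.emb y ∈ (extChartAt 𝓘(ℝ, E4) (F.emb x)).source := by
  have h := F.isSmoothEmbedding.contMDiff.continuous.continuousAt (x := x)
  exact Filter.Eventually.and (extChartAt_source_mem_nhds x) (h (extChartAt_source_mem_nhds (F.emb x)))

theorem chartCoframe_push {x y : S} (hy : y ∈ (extChartAt 𝓘(ℝ, E2) x).source)
    (hy' : F.emb y ∈ (extChartAt 𝓘(ℝ, E4) (F.emb x)).source) (v : TangentSpace 𝓘(ℝ, E2) y) :
    chartCoframe E4 (F.emb x) (F.emb y) (F.push y v) =
      fderiv ℝ (F.rep x) (extChartAt 𝓘(ℝ, E2) x y) (chartCoframe E2 x y v) :=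
  chartCoframe_mfderiv hy hy' (F.mdifferentiableAt_emb y) v

theorem push_eq_jac (x : S) (v : TangentSpace 𝓘(ℝ, E2) x) : F.push x v = F.jac x v :=
  mfderiv_eq_fderiv_localRep (F.mdifferentiableAt_emb x) v

/-- The equality holds on a neighbourhood, so both sides may be differentiated. -/
theorem inChart_firstFundamentalForm (x : S) :
    F.firstFundamentalForm.inChart x =ᶠ[𝓝 (extChartAt 𝓘(ℝ, E2) x x)] fun y =>
      (G.inChart (F.emb x) (F.rep x y)).bilinearComp (fderiv ℝ (F.rep x) y)
        (fderiv ℝ (F.rep x) y) := by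
  have hc : Filter.Tendsto (extChartAt 𝓘(ℝ, E2) x).symm (𝓝 (extChartAt 𝓘(ℝ, E2) x x)) (𝓝 x) := by
    have := continuousAt_extChartAt_symm (I := 𝓘(ℝ, E2)) x
    rwa [ContinuousAt, (extChartAt 𝓘(ℝ, E2) x).left_inv (mem_extChartAt_source x)] at this
  filter_upwards [hc.eventually (F.eventually_mem_source x),
    extChartAt_target_mem_nhds (I := 𝓘(ℝ, E2)) x] with y hy hyt
  obtain ⟨h1, h2⟩ := hy
  set z := (extChartAt 𝓘(ℝ, E2) x).symm y with hz
  have hyz : extChartAt 𝓘(ℝ, E2) x z = y := (extChartAt 𝓘(ℝ, E2) x).right_inv hyt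
  rw [← hyz]
  ext a b
  rw [MetricField.inChart_extChartAt _ h1]
  have h3 : F.rep x (extChartAt 𝓘(ℝ, E2) x z) = extChartAt 𝓘(ℝ, E4) (F.emb x) (F.emb z) := by
    simp only [rep, localRep, Function.comp_apply, (extChartAt 𝓘(ℝ, E2) x).left_inv h1]
  have h4 : ∀ a : E2, fderiv ℝ (F.rep x) (extChartAt 𝓘(ℝ, E2) x z) a =
      chartCoframe E4 (F.emb x) (F.emb z)
        (F.push z (show TangentSpace 𝓘(ℝ, E2) z from MetricField.chartFrame (E := E2) x z a)) := by
    intro a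
    rw [F.chartCoframe_push h1 h2, chartCoframe_chartFrame h1]
  rw [ContinuousLinearMap.bilinearComp_apply, h3, h4, h4, ← G.val_eq_inChart h2]
  rfl

theorem differentiableAt_inChart_rep (x : S) :
    DifferentiableAt ℝ (G.inChart (F.emb x)) (F.rep x (extChartAt 𝓘(ℝ, E2) x x)) := by
  rw [F.rep_self]
  exact (G.contDiffAt_inChart (F.emb x)).differentiableAt (by simp)

theorem differentiableAt_inChart_firstFundamentalForm (x : S) :
    DifferentiableAt ℝ (F.firstFundamentalForm.inChart x) (extChartAt 𝓘(ℝ, E2) x x) := by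
  refine DifferentiableAt.congr_of_eventuallyEq ?_ (F.inChart_firstFundamentalForm x)
  have h1 : DifferentiableAt ℝ (fun y => G.inChart (F.emb x) (F.rep x y))
      (extChartAt 𝓘(ℝ, E2) x x) :=
    DifferentiableAt.comp (G := E4 →L[ℝ] E4 →L[ℝ] ℝ) (g := G.inChart (F.emb x)) _
      (F.differentiableAt_inChart_rep x)
      ((F.contDiffAt_rep x).differentiableAt (by simp))
  exact differentiableAt_bilinearComp h1 (F.differentiableAt_fderiv_rep x)

/-- Each of the three derivatives of the pulled-back metric yields two Hessian terms. By symmetry of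
the Hessian four of the six cancel, and the two equal ones that survive absorb the factor `1/2`. -/
theorem christoffelFirst_firstFundamentalForm (x : S) (v w z : E2) :
    F.firstFundamentalForm.christoffelFirst x v w z =
      G.christoffelFirst (F.emb x) (F.jac x v) (F.jac x w) (F.jac x z)
        + G.form (F.emb x) (F.hess x v w) (F.jac x z) := by
  have hG : ∀ a b : E4, G.inChart (F.emb x) (F.rep x (extChartAt 𝓘(ℝ, E2) x x)) a b =
      G.form (F.emb x) a b := by
    intro a b
    rw [F.rep_self]
    exact G.inChart_self (F.emb x) a b
  have hs : ∀ a b : E4, G.form (F.emb x) a b = G.form (F.emb x) b a := G.symm (F.emb x)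
  have hD : ∀ z a b : E2,
      fderiv ℝ (F.firstFundamentalForm.inChart x) (extChartAt 𝓘(ℝ, E2) x x) z a b =
        fderiv ℝ (G.inChart (F.emb x)) (extChartAt 𝓘(ℝ, E4) (F.emb x) (F.emb x))
            (F.jac x z) (F.jac x a) (F.jac x b)
          + G.form (F.emb x) (F.hess x z a) (F.jac x b)
          + G.form (F.emb x) (F.hess x z b) (F.jac x a) := by
    intro z a b
    rw [(F.inChart_firstFundamentalForm x).fderiv_eq,
      fderiv_pullback_apply (F.differentiableAt_inChart_rep x)
        ((F.contDiffAt_rep x).differentiableAt (by simp)) (F.differentiableAt_fderiv_rep x),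
      hG, hG, F.rep_self, hs (fderiv ℝ (F.rep x) _ a)]
    rfl
  rw [MetricField.christoffelFirst_apply, MetricField.christoffelFirst_apply, hD, hD, hD,
    F.hess_symm x w v, F.hess_symm x z v, F.hess_symm x z w]
  ring

/-- The second covariant derivative `∂_v ∂_w f^a + Γ^a_{bc} ∂_v f^b ∂_w f^c` of the imbedding with
respect to coordinates of the surface. -/
def ambientAccel (x : S) (v w : TangentSpace 𝓘(ℝ, E2) x) : TangentSpace 𝓘(ℝ, E4) (F.emb x) :=
  (show TangentSpace 𝓘(ℝ, E4) (F.emb x) from F.hess x v w)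
    + G.christoffel (F.emb x) (F.push x v) (F.push x w)

/-- The covector obtained from `ambientAccel` by lowering the index. -/
def lowerAccel (x : S) (v w : E2) (n : E4) : ℝ :=
  G.form (F.emb x) (F.hess x v w) n + G.christoffelFirst (F.emb x) (F.jac x v) (F.jac x w) n

theorem val_ambientAccel (x : S) (v w : TangentSpace 𝓘(ℝ, E2) x)
    (n : TangentSpace 𝓘(ℝ, E4) (F.emb x)) :
    G.val (F.emb x) (F.ambientAccel x v w) n = F.lowerAccel x v w n := by
  have h := G.val_christoffel (F.emb x) (F.push x v) (F.push x w) n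
  rw [ambientAccel, map_add, add_apply, h, push_eq_jac, push_eq_jac]
  rfl

theorem lowerAccel_symm (x : S) (v w : E2) (n : E4) :
    F.lowerAccel x v w n = F.lowerAccel x w v n := by
  rw [lowerAccel, lowerAccel, F.hess_symm, MetricField.christoffelFirst_symm]
  exact (G.contDiffAt_inChart (F.emb x)).differentiableAt (by simp)

theorem lowerAccel_add_left (x : S) (v v' w : E2) (n : E4) :
    F.lowerAccel x (v + v') w n = F.lowerAccel x v w n + F.lowerAccel x v' w n := by
  rw [lowerAccel, lowerAccel, lowerAccel, (F.jac x).map_add, (F.hess x).map_add,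
    MetricField.christoffelFirst_add_left, add_apply, (G.form (F.emb x)).map_add, add_apply]
  ring

theorem lowerAccel_smul_left (x : S) (a : ℝ) (v w : E2) (n : E4) :
    F.lowerAccel x (a • v) w n = a * F.lowerAccel x v w n := by
  rw [lowerAccel, lowerAccel, (F.jac x).map_smul, (F.hess x).map_smul,
    MetricField.christoffelFirst_smul_left, smul_apply, (G.form (F.emb x)).map_smul, smul_apply,
    smul_eq_mul]
  ring

/-- The Gauss formula: the tangential part of the ambient covariant derivative is the covariant
derivative of the surface. -/
theorem ambientAccel_sub_mem_normal (x : S) (v w : TangentSpace 𝓘(ℝ, E2) x) :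
    F.ambientAccel x v w - F.push x (F.firstFundamentalForm.christoffel x v w) ∈ F.normal x := by
  rintro _ ⟨z, rfl⟩
  change G.val (F.emb x) (F.push x z) _ = 0
  rw [G.symm, map_sub, sub_apply, sub_eq_zero, val_ambientAccel]
  have h : G.val (F.emb x) (F.push x (F.firstFundamentalForm.christoffel x v w)) (F.push x z) =
      F.firstFundamentalForm.val x (F.firstFundamentalForm.christoffel x v w) z := rfl
  rw [h, MetricField.val_christoffel, push_eq_jac]
  refine Eq.trans ?_ (F.christoffelFirst_firstFundamentalForm x v w z).symm
  exact add_comm _ _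

/-- The extension of `w` has constant components, so the components of its push-forward are `Df ·
w`, whose derivative is the Hessian. -/
theorem shape_eq_normalPart (x : S) (v w : TangentSpace 𝓘(ℝ, E2) x) :
    F.shape x v w = -F.normalPart x (F.ambientAccel x v w) := by
  unfold shape shapeField covDerivAlong
  have h1 : components F.emb (fun y => F.push y (FiberBundle.extend E2 w y)) x =ᶠ[𝓝 x]
      (fun y => fderiv ℝ (F.rep x) y w) ∘ extChartAt 𝓘(ℝ, E2) x := by
    filter_upwards [F.eventually_mem_source x] with y hy
    rw [components_eq_chartCoframe hy.2, F.chartCoframe_push hy.1 hy.2, chartCoframe_extend hy.1]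
    rfl
  have h2 : HasFDerivAt (fun y => fderiv ℝ (F.rep x) y w) ((F.hess x).flip w)
      (extChartAt 𝓘(ℝ, E2) x x) := hasFDerivAt_fderiv_apply (F.differentiableAt_fderiv_rep x) w
  rw [mvfderiv_of_eventuallyEq h1 h2]
  simp only [FiberBundle.extend_apply_self]
  congr 2

theorem shape_eq (x : S) (v w : TangentSpace 𝓘(ℝ, E2) x) :
    F.shape x v w =
      F.push x (F.firstFundamentalForm.christoffel x v w) - F.ambientAccel x v w := by
  have h1 : F.ambientAccel x v w =
      (F.ambientAccel x v w - F.push x (F.firstFundamentalForm.christoffel x v w))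
        + F.push x (F.firstFundamentalForm.christoffel x v w) := by abel
  rw [shape_eq_normalPart, normalPart]
  nth_rewrite 1 [h1]
  have h2 : F.push x (F.firstFundamentalForm.christoffel x v w) ∈ F.tangent x :=
    LinearMap.mem_range_self _ _
  rw [map_add, Submodule.projection_apply_of_mem_left _ (F.ambientAccel_sub_mem_normal x v w),
    (Submodule.projection_apply_eq_zero_iff _).2 h2]
  abel

theorem shape_mem_normal (x : S) (v w : TangentSpace 𝓘(ℝ, E2) x) :
    F.shape x v w ∈ F.normal x := by
  rw [shape_eq, ← neg_sub]
  exact neg_mem (F.ambientAccel_sub_mem_normal x v w)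

/-- The tangential correction pairs to zero with `n`. Symmetry and bilinearity of `K_n` are thereby
inherited from the explicit expression `lowerAccel`. -/
theorem secondFundamentalForm_eq {x : S} {n : TangentSpace 𝓘(ℝ, E4) (F.emb x)}
    (hn : n ∈ F.normal x) (v w : TangentSpace 𝓘(ℝ, E2) x) :
    F.secondFundamentalForm x n v w = -F.lowerAccel x v w n := by
  have h : G.val (F.emb x) (F.push x (F.firstFundamentalForm.christoffel x v w)) n = 0 :=
    hn _ (LinearMap.mem_range_self _ _)
  rw [secondFundamentalForm, G.symm, shape_eq, map_sub, sub_apply, h, val_ambientAccel, zero_sub]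

theorem secondFundamentalForm_symm {x : S} {n : TangentSpace 𝓘(ℝ, E4) (F.emb x)}
    (hn : n ∈ F.normal x) (v w : TangentSpace 𝓘(ℝ, E2) x) :
    F.secondFundamentalForm x n v w = F.secondFundamentalForm x n w v := by
  rw [F.secondFundamentalForm_eq hn, F.secondFundamentalForm_eq hn]
  exact congrArg Neg.neg (F.lowerAccel_symm x v w n)

theorem secondFundamentalForm_add_left {x : S} {n : TangentSpace 𝓘(ℝ, E4) (F.emb x)}
    (hn : n ∈ F.normal x) (v v' w : TangentSpace 𝓘(ℝ, E2) x) :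
    F.secondFundamentalForm x n (v + v') w =
      F.secondFundamentalForm x n v w + F.secondFundamentalForm x n v' w := by
  have h := F.lowerAccel_add_left x v v' w n
  rw [F.secondFundamentalForm_eq hn, F.secondFundamentalForm_eq hn, F.secondFundamentalForm_eq hn,
    ← neg_add]
  exact congrArg Neg.neg h

theorem secondFundamentalForm_smul_left {x : S} {n : TangentSpace 𝓘(ℝ, E4) (F.emb x)}
    (hn : n ∈ F.normal x) (a : ℝ) (v w : TangentSpace 𝓘(ℝ, E2) x) :
    F.secondFundamentalForm x n (a • v) w = a * F.secondFundamentalForm x n v w := by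
  have h := F.lowerAccel_smul_left x a v w n
  rw [F.secondFundamentalForm_eq hn, F.secondFundamentalForm_eq hn, mul_neg]
  exact congrArg Neg.neg h

end SpacelikeSurface

end Surfaces

/-! ### Curvature of loops in coordinates -/

namespace ClosedLoop

variable {V : Type*} [TopologicalSpace V] [ChartedSpace E4 V] [IsManifold 𝓘(ℝ, E4) ∞ V]
  {G : Spacetime V} {S : Type*} [TopologicalSpace S] [ChartedSpace E2 S]
  [IsManifold 𝓘(ℝ, E2) ∞ S] (C : ClosedLoop S) (F : SpacelikeSurface G S)

/-- The curve in the chart at its point of parameter `t`. -/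
def inChart (t s : ℝ) : E2 := extChartAt 𝓘(ℝ, E2) (C.curve t) (C.curve s)

omit [IsManifold 𝓘(ℝ, E2) ∞ S] in
theorem localRep_curve (t : ℝ) : localRep E2 ℝ C.curve t = C.inChart t := by
  rfl

omit [IsManifold 𝓘(ℝ, E2) ∞ S] in
theorem mdifferentiableAt_curve (t : ℝ) : MDifferentiableAt 𝓘(ℝ, ℝ) 𝓘(ℝ, E2) C.curve t :=
  (C.contMDiff t).mdifferentiableAt (by simp)

omit [IsManifold 𝓘(ℝ, E2) ∞ S] in
theorem contDiffAt_inChart (t : ℝ) : ContDiffAt ℝ 2 (C.inChart t) t := by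
  rw [← localRep_curve]
  exact contDiffAt_localRep (E := E2) (E' := ℝ) t (C.contMDiff t)

omit [IsManifold 𝓘(ℝ, E2) ∞ S] in
theorem hasDerivAt_deriv_inChart (t : ℝ) :
    HasDerivAt (deriv (C.inChart t)) (deriv (deriv (C.inChart t)) t) t := by
  have h : ContDiffAt ℝ 1 (deriv (C.inChart t)) t := by
    have h1 := (C.contDiffAt_inChart t).fderiv_right (m := 1) (by norm_num)
    exact h1.clm_apply contDiffAt_const
  exact (h.differentiableAt one_ne_zero).hasDerivAt

omit [IsManifold 𝓘(ℝ, E2) ∞ S] in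
theorem hasDerivAt_inChart (t : ℝ) : HasDerivAt (C.inChart t) (deriv (C.inChart t) t) t :=
  ((C.contDiffAt_inChart t).differentiableAt (by simp)).hasDerivAt

omit [IsManifold 𝓘(ℝ, E2) ∞ S] in
theorem eventually_curve_mem_source (t : ℝ) :
    ∀ᶠ s in 𝓝 t, C.curve s ∈ (extChartAt 𝓘(ℝ, E2) (C.curve t)).source :=
  C.contMDiff.continuous.continuousAt (extChartAt_source_mem_nhds (C.curve t))

theorem chartCoframe_velocity {t s : ℝ}
    (hs : C.curve s ∈ (extChartAt 𝓘(ℝ, E2) (C.curve t)).source) :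
    chartCoframe E2 (C.curve t) (C.curve s) (C.velocity s) = deriv (C.inChart t) s := by
  have h := chartCoframe_mfderiv (E := E2) (E' := ℝ) (f := C.curve) (x := t) (y := s)
    (by rw [extChartAt_model_space_eq_id]; exact Set.mem_univ s) hs
    (C.mdifferentiableAt_curve s) (1 : ℝ)
  have h1 : chartCoframe ℝ t s (1 : ℝ) = (1 : ℝ) := by
    unfold chartCoframe
    rw [TangentBundle.continuousLinearMapAt_model_space]
    rfl
  rw [h1, localRep_curve] at h
  exact h

theorem speed_pos (t : ℝ) : 0 < C.speed F t :=
  Real.sqrt_pos.2 (F.spacelike _ _ (C.regular t))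

/-- The velocity of a `C^2` curve has differentiable components, and regularity keeps the radicand
away from zero. -/
theorem differentiableAt_speed (t : ℝ) : DifferentiableAt ℝ (C.speed F) t := by
  set h := F.firstFundamentalForm.inChart (C.curve t)
  have h1 : C.speed F =ᶠ[𝓝 t] fun s =>
      √(h (C.inChart t s) (deriv (C.inChart t) s) (deriv (C.inChart t) s)) := by
    filter_upwards [C.eventually_curve_mem_source t] with s hs
    rw [speed, F.firstFundamentalForm.val_eq_inChart hs, C.chartCoframe_velocity hs]
    rfl
  have h2 : DifferentiableAt ℝ (fun s => h (C.inChart t s)) t :=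
    DifferentiableAt.comp (F := E2) (G := E2 →L[ℝ] E2 →L[ℝ] ℝ) (g := h) (f := C.inChart t) t
      (F.differentiableAt_inChart_firstFundamentalForm (C.curve t))
      (C.hasDerivAt_inChart t).differentiableAt
  have h3 := (C.hasDerivAt_deriv_inChart t).differentiableAt
  have h4 : DifferentiableAt ℝ
      (fun s => h (C.inChart t s) (deriv (C.inChart t) s) (deriv (C.inChart t) s)) t :=
    (h2.clm_apply h3).clm_apply h3
  refine DifferentiableAt.congr_of_eventuallyEq (h4.sqrt ?_) h1
  have h5 := C.speed_pos F t
  rw [h1.eq_of_nhds] at h5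
  exact (Real.sqrt_pos.1 h5).ne'

/-- The components of the unit tangent vector in the chart at the point of parameter `t`. -/
def unitComponents (t s : ℝ) : E2 := (C.speed F s)⁻¹ • deriv (C.inChart t) s

theorem hasDerivAt_unitComponents (t : ℝ) :
    HasDerivAt (C.unitComponents F t) (deriv (C.unitComponents F t) t) t :=
  (((C.differentiableAt_speed F t).inv (C.speed_pos F t).ne').smul
    (C.hasDerivAt_deriv_inChart t).differentiableAt).hasDerivAt

theorem chartCoframe_unitTangent {t s : ℝ}
    (hs : C.curve s ∈ (extChartAt 𝓘(ℝ, E2) (C.curve t)).source) :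
    chartCoframe E2 (C.curve t) (C.curve s) (C.unitTangent F s) = C.unitComponents F t s := by
  rw [unitTangent, map_smul, chartCoframe_velocity _ hs]
  rfl

theorem unitComponents_self (t : ℝ) : C.unitComponents F t t = C.unitTangent F t := by
  rw [← C.chartCoframe_unitTangent F (mem_extChartAt_source _), chartCoframe_self]

theorem mfderiv_curve_inv_speed (t : ℝ) :
    mfderiv 𝓘(ℝ, ℝ) 𝓘(ℝ, E2) C.curve t ((C.speed F t)⁻¹ : ℝ) = C.unitTangent F t := by
  have h : (show TangentSpace 𝓘(ℝ, ℝ) t from ((C.speed F t)⁻¹ : ℝ)) =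
      (C.speed F t)⁻¹ • (show TangentSpace 𝓘(ℝ, ℝ) t from (1 : ℝ)) :=
    (mul_one ((C.speed F t)⁻¹)).symm
  exact (congrArg _ h).trans (map_smul _ _ _)

/-- The components of `d/ds` of the unit tangent vector, `s` being the arc length. -/
def unitAccel (t : ℝ) : TangentSpace 𝓘(ℝ, E2) (C.curve t) :=
  (C.speed F t)⁻¹ • (show TangentSpace 𝓘(ℝ, E2) (C.curve t) from deriv (C.unitComponents F t) t)

theorem curvatureInSurface_eq (t : ℝ) :
    C.curvatureInSurface F t = -(C.unitAccel F t
      + F.firstFundamentalForm.christoffel (C.curve t) (C.unitTangent F t)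
        (C.unitTangent F t)) := by
  have h1 : components C.curve (C.unitTangent F) t =ᶠ[𝓝 t]
      C.unitComponents F t ∘ extChartAt 𝓘(ℝ, ℝ) t := by
    filter_upwards [C.eventually_curve_mem_source t] with s hs
    rw [components_eq_chartCoframe hs, C.chartCoframe_unitTangent F hs]
    rfl
  have h2 : mvfderiv 𝓘(ℝ, ℝ) (components C.curve (C.unitTangent F) t) t ((C.speed F t)⁻¹ : ℝ) =
      (C.speed F t)⁻¹ • deriv (C.unitComponents F t) t :=
    mvfderiv_of_eventuallyEq h1 (h' := ContinuousLinearMap.toSpanSingleton ℝ _)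
      (C.hasDerivAt_unitComponents F t).hasFDerivAt _
  unfold curvatureInSurface covDerivAlong
  rw [mfderiv_curve_inv_speed]
  exact congrArg (fun u : TangentSpace 𝓘(ℝ, E2) (C.curve t) =>
    -(u + F.firstFundamentalForm.christoffel (C.curve t) (C.unitTangent F t) (C.unitTangent F t))) h2

theorem curvatureInSpacetime_eq (t : ℝ) :
    C.curvatureInSpacetime F t = -(F.push (C.curve t) (C.unitAccel F t)
      + F.ambientAccel (C.curve t) (C.unitTangent F t) (C.unitTangent F t)) := by
  have h1 : components (fun s => F.emb (C.curve s))
      (fun s => F.push (C.curve s) (C.unitTangent F s)) t =ᶠ[𝓝 t]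
      (fun s => fderiv ℝ (F.rep (C.curve t)) (C.inChart t s) (C.unitComponents F t s))
        ∘ extChartAt 𝓘(ℝ, ℝ) t := by
    filter_upwards [C.contMDiff.continuous.continuousAt.eventually
      (F.eventually_mem_source (C.curve t))] with s hs
    rw [components_eq_chartCoframe (f := fun s => F.emb (C.curve s)) hs.2, F.chartCoframe_push hs.1 hs.2,
      C.chartCoframe_unitTangent F hs.1]
    rfl
  have h2 : HasFDerivAt
      (fun s => fderiv ℝ (F.rep (C.curve t)) (C.inChart t s) (C.unitComponents F t s))
      (ContinuousLinearMap.toSpanSingleton ℝ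
        (F.hess (C.curve t) (deriv (C.inChart t) t) (C.unitComponents F t t)
          + F.jac (C.curve t) (deriv (C.unitComponents F t) t))) t := by
    have h3 := (F.differentiableAt_fderiv_rep (C.curve t)).hasFDerivAt.comp_hasDerivAt t
      (C.hasDerivAt_inChart t)
    exact (h3.clm_apply (C.hasDerivAt_unitComponents F t)).hasFDerivAt
  have h4 : mfderiv 𝓘(ℝ, ℝ) 𝓘(ℝ, E4) (fun s => F.emb (C.curve s)) t ((C.speed F t)⁻¹ : ℝ) =
      F.push (C.curve t) (C.unitTangent F t) := by
    rw [← mfderiv_curve_inv_speed]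
    exact DFunLike.congr_fun
      (mfderiv_comp t (F.mdifferentiableAt_emb _) (C.mdifferentiableAt_curve t)) _
  -- The factor `1 / speed` enters the first slot of the Hessian and turns the chart velocity there
  -- into the unit tangent.
  have h5 : (C.speed F t)⁻¹ • (F.hess (C.curve t) (deriv (C.inChart t) t) (C.unitComponents F t t)
          + F.jac (C.curve t) (deriv (C.unitComponents F t) t)) =
      F.jac (C.curve t) ((C.speed F t)⁻¹ • deriv (C.unitComponents F t) t)
        + F.hess (C.curve t) (C.unitComponents F t t) (C.unitComponents F t t) := by
    have h := (F.hess (C.curve t)).map_smul (C.speed F t)⁻¹ (deriv (C.inChart t) t)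
    change _ = _ + F.hess (C.curve t) ((C.speed F t)⁻¹ • deriv (C.inChart t) t)
      (C.unitComponents F t t)
    rw [h, (F.jac (C.curve t)).map_smul, smul_add, add_comm]
    rfl
  have h6 : mvfderiv 𝓘(ℝ, ℝ) (components (fun s => F.emb (C.curve s))
      (fun s => F.push (C.curve s) (C.unitTangent F s)) t) t ((C.speed F t)⁻¹ : ℝ) =
      F.jac (C.curve t) ((C.speed F t)⁻¹ • deriv (C.unitComponents F t) t)
        + F.hess (C.curve t) (C.unitTangent F t) (C.unitTangent F t) := by
    rw [C.unitComponents_self] at h5 h2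
    exact (mvfderiv_of_eventuallyEq h1 h2 _).trans h5
  have h7 := F.push_eq_jac (C.curve t) (C.unitAccel F t)
  unfold curvatureInSpacetime covDerivAlong
  rw [h4, h7, SpacelikeSurface.ambientAccel]
  exact (congrArg (fun u : TangentSpace 𝓘(ℝ, E4) (F.emb (C.curve t)) =>
    -(u + G.christoffel (F.emb (C.curve t)) (F.push (C.curve t) (C.unitTangent F t))
      (F.push (C.curve t) (C.unitTangent F t)))) h6).trans (congrArg Neg.neg (add_assoc _ _ _))

/-- The difference of the mean curvature vectors of a curve is the shape tensor on its unit tangent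
vector. -/
theorem outwardCurvature_eq_shape (t : ℝ) :
    C.outwardCurvature F t = F.shape (C.curve t) (C.unitTangent F t) (C.unitTangent F t) := by
  -- The pushed-forward `unitAccel` occurs in both curvatures and cancels.
  rw [outwardCurvature, curvatureInSpacetime_eq, curvatureInSurface_eq, F.shape_eq, map_neg,
    map_add]
  abel

end ClosedLoop

/-! ### Binary quadratic forms -/

/-- A binary quadratic form of positive determinant whose trace with respect to a positive-definite
form is negative is negative definite. -/
theorem quadratic_neg_of_trace_neg_of_det_pos {g₀ g₁ g₂ a b c : ℝ} (h0 : 0 < g₀) (h2 : 0 < g₂)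
    (hg : 0 < g₀ * g₂ - g₁ ^ 2) (htr : g₂ * a - 2 * g₁ * b + g₀ * c < 0)
    (hdet : 0 < a * c - b ^ 2) {x y : ℝ} (hxy : x ≠ 0 ∨ y ≠ 0) :
    a * x ^ 2 + 2 * b * (x * y) + c * y ^ 2 < 0 := by
  have hac : 0 < a * c := by nlinarith [sq_nonneg b]
  -- Otherwise `a, c > 0`, and the trace condition gives `(g₂a + g₀c)² < 4g₁²b² ≤ 4g₀g₂ac`, contrary
  -- to `(g₂a - g₀c)² ≥ 0`.
  have ha : a < 0 := by
    by_contra! h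
    have ha : 0 < a := lt_of_le_of_ne h (by rintro rfl; simp at hac)
    have hc : 0 < c := pos_of_mul_pos_right hac ha.le
    have h1 : 0 < g₂ * a + g₀ * c := by positivity
    have h3 : (g₂ * a + g₀ * c) ^ 2 < (2 * g₁ * b) ^ 2 := by
      have : g₂ * a + g₀ * c < 2 * g₁ * b := by linarith
      exact pow_lt_pow_left₀ this h1.le two_ne_zero
    have h4 : g₁ ^ 2 * b ^ 2 ≤ g₀ * g₂ * (a * c) :=
      mul_le_mul (by linarith) (by linarith) (sq_nonneg b) (by positivity)
    nlinarith [sq_nonneg (g₂ * a - g₀ * c)]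
  -- Completing the square: this is `a` times the quadratic form.
  have h5 : 0 < (a * x + b * y) ^ 2 + (a * c - b ^ 2) * y ^ 2 := by
    by_cases hy : y = 0
    · have hx : x ≠ 0 := hxy.resolve_right (not_not.2 hy)
      subst hy
      have := pow_pos (abs_pos.2 (mul_ne_zero ha.ne hx)) 2
      rw [sq_abs] at this
      simpa using this
    · have : 0 < (a * c - b ^ 2) * y ^ 2 := by positivity
      linarith [sq_nonneg (a * x + b * y)]
  have h6 : 0 < a * (a * x ^ 2 + 2 * b * (x * y) + c * y ^ 2) := by linarith
  exact neg_of_mul_pos_right h6 ha.le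

/-- A binary quadratic form of nonnegative determinant whose trace with respect to a
positive-definite form vanishes is zero. -/
theorem quadratic_eq_zero_of_trace_eq_zero {g₀ g₁ g₂ a b c : ℝ} (h0 : 0 < g₀) (h2 : 0 < g₂)
    (hg : 0 < g₀ * g₂ - g₁ ^ 2) (htr : g₂ * a - 2 * g₁ * b + g₀ * c = 0)
    (hdet : 0 ≤ a * c - b ^ 2) : a = 0 ∧ b = 0 ∧ c = 0 := by
  have h3 : (g₂ * a + g₀ * c) ^ 2 = 4 * (g₁ ^ 2 * b ^ 2) := by
    rw [show g₂ * a + g₀ * c = 2 * g₁ * b by linarith]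
    ring
  have h4 : g₁ ^ 2 * b ^ 2 ≤ g₁ ^ 2 * (a * c) :=
    mul_le_mul_of_nonneg_left (by linarith) (sq_nonneg _)
  -- From `4g₀g₂ac ≤ (g₂a + g₀c)² = 4g₁²b² ≤ 4g₁²ac`. Together with `b² ≤ ac` this forces `ac = b =
  -- 0`.
  have h5 : (g₀ * g₂ - g₁ ^ 2) * (a * c) ≤ 0 := by nlinarith [sq_nonneg (g₂ * a - g₀ * c)]
  have hac : a * c ≤ 0 := nonpos_of_mul_nonpos_right h5 hg
  have hb : b = 0 := by
    have : b ^ 2 = 0 := le_antisymm (by linarith) (sq_nonneg b)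
    simpa using this
  have hac0 : a * c = 0 := le_antisymm hac (by nlinarith)
  subst hb
  rcases mul_eq_zero.1 hac0 with h | h <;> subst h
  · have : g₀ * c = 0 := by linarith
    exact ⟨rfl, rfl, (mul_eq_zero.1 this).resolve_left h0.ne'⟩
  · have : g₂ * a = 0 := by linarith
    exact ⟨(mul_eq_zero.1 this).resolve_left h2.ne', rfl, rfl⟩

variable {V : Type*} [TopologicalSpace V] [ChartedSpace E4 V] [IsManifold 𝓘(ℝ, E4) ∞ V]
  {G : Spacetime V} {S : Type*} [TopologicalSpace S] [ChartedSpace E2 S]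
  [IsManifold 𝓘(ℝ, E2) ∞ S]

/-! ### Null bases of the normal plane and causal character -/

namespace SpacelikeSurface

variable {F : SpacelikeSurface G S} {x : S}

theorem push_injective (F : SpacelikeSurface G S) (x : S) : Function.Injective (F.push x) := by
  refine (injective_iff_map_eq_zero _).2 fun v hv => ?_
  by_contra h
  have h1 := F.spacelike x v h
  change 0 < G.val (F.emb x) (F.push x v) (F.push x v) at h1
  rw [hv] at h1
  simp at h1

theorem finrank_normal (F : SpacelikeSurface G S) (x : S) :
    Module.finrank ℝ (F.normal x) = 2 := by
  have : FiniteDimensional ℝ (TangentSpace 𝓘(ℝ, E4) (F.emb x)) := (inferInstance :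
    FiniteDimensional ℝ E4)
  have h1 := Submodule.finrank_add_eq_of_isCompl (F.isCompl_normal_tangent x)
  have h2 : Module.finrank ℝ (F.tangent x) = 2 := by
    rw [tangent, LinearMap.finrank_range_of_inj (F.push_injective x)]
    exact finrank_euclideanSpace_fin (𝕜 := ℝ)
  have h3 : Module.finrank ℝ (TangentSpace 𝓘(ℝ, E4) (F.emb x)) = 4 :=
    finrank_euclideanSpace_fin (𝕜 := ℝ)
  omega

namespace IsNullNormalPair

variable {l k : TangentSpace 𝓘(ℝ, E4) (F.emb x)} (h : F.IsNullNormalPair x l k)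

include h

theorem symm : F.IsNullNormalPair x k l :=
  ⟨h.right_mem, h.left_mem, h.right_null, h.left_null, by rw [G.symm, h.normalized]⟩

theorem val_left_comb (p q : ℝ) : G.val (F.emb x) l (p • l + q • k) = -q := by
  rw [map_add, map_smul, map_smul, h.left_null.2.1, h.normalized]
  simp

theorem val_right_comb (p q : ℝ) : G.val (F.emb x) k (p • l + q • k) = -p := by
  rw [add_comm, h.symm.val_left_comb]

/-- Pairing with `l` and `k` recovers the coefficients of a combination, so the two vectors are
independent in a plane. -/
theorem normal_eq_span : F.normal x = Submodule.span ℝ {l, k} := by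
  have : FiniteDimensional ℝ (TangentSpace 𝓘(ℝ, E4) (F.emb x)) := (inferInstance :
    FiniteDimensional ℝ E4)
  have hli : LinearIndependent ℝ ![l, k] := by
    refine LinearIndependent.pair_iff.2 fun s t hst => ?_
    have h1 := h.val_left_comb s t
    have h2 := h.val_right_comb s t
    rw [hst, map_zero] at h1 h2
    exact ⟨by linarith, by linarith⟩
  have hle : Submodule.span ℝ {l, k} ≤ F.normal x :=
    Submodule.span_le.2 (by rintro _ (rfl | rfl); exacts [h.left_mem, h.right_mem])
  refine (Submodule.eq_of_le_of_finrank_eq hle ?_).symm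
  have h3 := finrank_span_eq_card hli
  rw [Matrix.range_cons, Matrix.range_cons, Matrix.range_empty, Set.union_empty] at h3
  rw [finrank_normal]
  exact h3

/-- The expansion of a normal vector in a null basis. -/
theorem eq_of_mem_normal {n : TangentSpace 𝓘(ℝ, E4) (F.emb x)} (hn : n ∈ F.normal x) :
    n = -(G.val (F.emb x) k n) • l - (G.val (F.emb x) l n) • k := by
  rw [h.normal_eq_span] at hn
  obtain ⟨p, q, rfl⟩ := Submodule.mem_span_pair.1 hn
  rw [h.val_left_comb, h.val_right_comb]
  module

theorem val_self (p q : ℝ) :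
    G.val (F.emb x) (-p • l - q • k) (-p • l - q • k) = -(2 * (p * q)) := by
  have h1 := h.val_left_comb (-p) (-q)
  have h2 := h.val_right_comb (-p) (-q)
  have e : -p • l - q • k = -p • l + -q • k := by module
  rw [e]
  nth_rewrite 1 [map_add, map_smul, map_smul]
  rw [G.symm _ _ l, G.symm _ _ k, h1, h2, smul_eq_mul, smul_eq_mul]
  ring

omit h in
theorem val_time (p q : ℝ) :
    G.val (F.emb x) (-p • l - q • k) (G.time (F.emb x)) =
      -(p * G.val (F.emb x) l (G.time (F.emb x)) + q * G.val (F.emb x) k (G.time (F.emb x))) := by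
  rw [map_sub, map_smul, map_smul, sub_apply, smul_apply, smul_apply, smul_eq_mul, smul_eq_mul]
  ring

/-- The norm `-2pq` makes `p` and `q` of equal sign; since `l` and `k` pair negatively with the time
field, the orientation decides which sign. -/
theorem isFutureTimelike_iff (p q : ℝ) :
    G.IsFutureTimelike (x := F.emb x) (-p • l - q • k) ↔ p < 0 ∧ q < 0 := by
  have hl := h.left_null.2.2
  have hk := h.right_null.2.2
  rw [Spacetime.IsFutureTimelike, h.val_self, val_time]
  constructor
  · rintro ⟨h1, h2⟩
    rcases pos_and_pos_or_neg_and_neg_of_mul_pos (show 0 < p * q by linarith) with h3 | h3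
    · nlinarith [mul_neg_of_pos_of_neg h3.1 hl, mul_neg_of_pos_of_neg h3.2 hk]
    · exact h3
  · rintro ⟨h1, h2⟩
    have := mul_pos_of_neg_of_neg h1 h2
    have h3 := mul_pos_of_neg_of_neg h1 hl
    have h4 := mul_pos_of_neg_of_neg h2 hk
    constructor <;> linarith

theorem isPastTimelike_iff (p q : ℝ) :
    G.IsPastTimelike (x := F.emb x) (-p • l - q • k) ↔ 0 < p ∧ 0 < q := by
  have h1 := h.isFutureTimelike_iff (-p) (-q)
  rw [neg_lt_zero, neg_lt_zero] at h1
  rw [← h1, Spacetime.IsFutureTimelike, Spacetime.IsPastTimelike, h.val_self, h.val_self, val_time,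
    val_time]
  constructor <;> rintro ⟨h2, h3⟩ <;> constructor <;> linarith

theorem isFutureNull_iff (p q : ℝ) :
    G.IsFutureNull (x := F.emb x) (-p • l - q • k) ↔ p = 0 ∧ q < 0 ∨ q = 0 ∧ p < 0 := by
  have hl := h.left_null.2.2
  have hk := h.right_null.2.2
  rw [Spacetime.IsFutureNull, h.val_self, val_time]
  constructor
  · rintro ⟨-, h1, h2⟩
    rcases mul_eq_zero.1 (show p * q = 0 by linarith) with h3 | h3
    · subst h3
      exact Or.inl ⟨rfl, by by_contra! h4; nlinarith⟩
    · subst h3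
      exact Or.inr ⟨rfl, by by_contra! h4; nlinarith⟩
  · intro h1
    have h2 : -(p * G.val (F.emb x) l (G.time (F.emb x))
        + q * G.val (F.emb x) k (G.time (F.emb x))) < 0 := by
      rcases h1 with ⟨rfl, h4⟩ | ⟨rfl, h4⟩ <;> nlinarith
    -- The vector is nonzero because its pairing with the time field is.
    refine ⟨fun h0 => ?_, ?_, h2⟩
    · rw [← val_time, h0, map_zero, zero_apply] at h2
      exact lt_irrefl _ h2
    · rcases h1 with ⟨rfl, -⟩ | ⟨rfl, -⟩ <;> simp

theorem of_isPastNull {p q : ℝ} (hpq : G.IsPastNull (x := F.emb x) (-p • l - q • k)) :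
    p = 0 ∧ 0 < q ∨ q = 0 ∧ 0 < p := by
  have hl := h.left_null.2.2
  have hk := h.right_null.2.2
  rw [Spacetime.IsPastNull, h.val_self, val_time] at hpq
  obtain ⟨-, h1, h2⟩ := hpq
  rcases mul_eq_zero.1 (show p * q = 0 by linarith) with h3 | h3
  · subst h3
    exact Or.inl ⟨rfl, by by_contra! h4; nlinarith⟩
  · subst h3
    exact Or.inr ⟨rfl, by by_contra! h4; nlinarith⟩

theorem shape_eq_comb (v w : TangentSpace 𝓘(ℝ, E2) x) :
    F.shape x v w =
      -(F.secondFundamentalForm x k v w) • l - (F.secondFundamentalForm x l v w) • k :=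
  h.eq_of_mem_normal (F.shape_mem_normal x v w)

end IsNullNormalPair

/-- The trace of the second fundamental form relative to `n`. -/
def traceSecond (F : SpacelikeSurface G S) (x : S) (n : TangentSpace 𝓘(ℝ, E4) (F.emb x)) : ℝ :=
  G.val (F.emb x) n (F.meanCurvature x)

theorem IsNullNormalPair.meanCurvature_eq_comb {l k : TangentSpace 𝓘(ℝ, E4) (F.emb x)}
    (h : F.IsNullNormalPair x l k) :
    F.meanCurvature x = -(F.traceSecond x k) • l - (F.traceSecond x l) • k :=
  h.eq_of_mem_normal (sum_mem fun _ _ => sum_mem fun _ _ =>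
    Submodule.smul_mem _ _ (F.shape_mem_normal x _ _))

/-! ### Trace, determinant and definiteness in the coordinate basis -/

section Coordinates

variable (F x)

omit [IsManifold 𝓘(ℝ, E2) ∞ S] in
theorem eq_coord_comb (v : TangentSpace 𝓘(ℝ, E2) x) :
    ∃ a b : ℝ, v = a • coord x 0 + b • coord x 1 := by
  refine ⟨(show E2 from v) 0, (show E2 from v) 1, ?_⟩
  have : ∀ u : E2, u = u 0 • (EuclideanSpace.single 0 (1 : ℝ) : E2)
      + u 1 • (EuclideanSpace.single 1 (1 : ℝ) : E2) := by
    intro u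
    ext i
    fin_cases i <;> simp
  exact this v

omit [IsManifold 𝓘(ℝ, E2) ∞ S] in
theorem coord_comb_ne_zero {a b : ℝ} (h : a ≠ 0 ∨ b ≠ 0) :
    a • coord x 0 + b • coord x 1 ≠ 0 := by
  intro h0
  have h1 : (a • (EuclideanSpace.single 0 (1 : ℝ) : E2) + b • (EuclideanSpace.single 1 (1 : ℝ) : E2))
      = 0 := h0
  have h2 := congrFun (congrArg WithLp.ofLp h1) 0
  have h3 := congrFun (congrArg WithLp.ofLp h1) 1
  simp at h2 h3
  exact h.elim (fun h => h h2) (fun h => h h3)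

theorem gram_symm : F.gram x 1 0 = F.gram x 0 1 :=
  F.firstFundamentalForm.symm x _ _

theorem val_coord_comb (a b : ℝ) :
    F.firstFundamentalForm.val x (a • coord x 0 + b • coord x 1) (a • coord x 0 + b • coord x 1) =
      F.gram x 0 0 * a ^ 2 + 2 * F.gram x 0 1 * (a * b) + F.gram x 1 1 * b ^ 2 := by
  have h := F.gram_symm x
  simp only [gram, Matrix.of_apply] at h ⊢
  simp only [map_add, map_smul, add_apply, smul_apply, smul_eq_mul, h]
  ring

theorem gram_pos {a b : ℝ} (h : a ≠ 0 ∨ b ≠ 0) :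
    0 < F.gram x 0 0 * a ^ 2 + 2 * F.gram x 0 1 * (a * b) + F.gram x 1 1 * b ^ 2 := by
  rw [← val_coord_comb]
  exact F.spacelike x _ (coord_comb_ne_zero x h)

theorem gram_zero_zero_pos : 0 < F.gram x 0 0 := by
  simpa using F.gram_pos x (a := 1) (b := 0) (by simp)

theorem gram_one_one_pos : 0 < F.gram x 1 1 := by
  simpa using F.gram_pos x (a := 0) (b := 1) (by simp)

theorem gram_det_pos : 0 < F.gram x 0 0 * F.gram x 1 1 - F.gram x 0 1 ^ 2 := by
  have h0 := F.gram_zero_zero_pos x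
  -- On this vector the form takes the value `g₀₀` times the determinant.
  have h := F.gram_pos x (a := F.gram x 0 1) (b := -F.gram x 0 0) (Or.inr (neg_ne_zero.2 h0.ne'))
  refine pos_of_mul_pos_right (a := F.gram x 0 0) ?_ h0.le
  linarith

variable {F x} {n : TangentSpace 𝓘(ℝ, E4) (F.emb x)} (hn : n ∈ F.normal x)

include hn

theorem secondFundamentalForm_coord_comb (a b : ℝ) :
    F.secondFundamentalForm x n (a • coord x 0 + b • coord x 1) (a • coord x 0 + b • coord x 1) =
      F.secondFundamentalForm x n (coord x 0) (coord x 0) * a ^ 2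
        + 2 * F.secondFundamentalForm x n (coord x 0) (coord x 1) * (a * b)
        + F.secondFundamentalForm x n (coord x 1) (coord x 1) * b ^ 2 := by
  rw [F.secondFundamentalForm_add_left hn, F.secondFundamentalForm_smul_left hn,
    F.secondFundamentalForm_smul_left hn,
    F.secondFundamentalForm_symm hn (coord x 0) (a • coord x 0 + b • coord x 1),
    F.secondFundamentalForm_symm hn (coord x 1) (a • coord x 0 + b • coord x 1)]
  rw [F.secondFundamentalForm_add_left hn, F.secondFundamentalForm_add_left hn,
    F.secondFundamentalForm_smul_left hn, F.secondFundamentalForm_smul_left hn,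
    F.secondFundamentalForm_smul_left hn, F.secondFundamentalForm_smul_left hn,
    F.secondFundamentalForm_symm hn (coord x 1) (coord x 0)]
  ring

theorem detSecond_eq :
    F.detSecond x n = F.secondFundamentalForm x n (coord x 0) (coord x 0)
        * F.secondFundamentalForm x n (coord x 1) (coord x 1)
      - F.secondFundamentalForm x n (coord x 0) (coord x 1) ^ 2 := by
  rw [detSecond, Matrix.det_fin_two]
  simp only [Matrix.of_apply, F.secondFundamentalForm_symm hn (coord x 1) (coord x 0)]
  ring

/-- The inverse Gram matrix is its adjugate over its determinant; clearing this denominator gives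
the trace in the form used for quadratic forms above. -/
theorem det_mul_traceSecond :
    (F.gram x 0 0 * F.gram x 1 1 - F.gram x 0 1 ^ 2) * F.traceSecond x n =
      F.gram x 1 1 * F.secondFundamentalForm x n (coord x 0) (coord x 0)
        - 2 * F.gram x 0 1 * F.secondFundamentalForm x n (coord x 0) (coord x 1)
        + F.gram x 0 0 * F.secondFundamentalForm x n (coord x 1) (coord x 1) := by
  have hd := F.gram_det_pos x
  have hdet : (F.gram x).det = F.gram x 0 0 * F.gram x 1 1 - F.gram x 0 1 ^ 2 := by
    rw [Matrix.det_fin_two, F.gram_symm]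
    ring
  have hs := F.secondFundamentalForm_symm hn (coord x 1) (coord x 0)
  have htr : F.traceSecond x n = ∑ i, ∑ j, (F.gram x)⁻¹ i j *
      F.secondFundamentalForm x n (coord x i) (coord x j) := by
    simp only [traceSecond, meanCurvature, map_sum, map_smul, smul_eq_mul]
    rfl
  rw [htr, Matrix.inv_def, Matrix.adjugate_fin_two, Ring.inverse_eq_inv, hdet]
  simp only [Fin.sum_univ_two, Matrix.smul_apply, Matrix.of_apply, Matrix.cons_val', Matrix.cons_val_zero,
    Matrix.cons_val_one, smul_eq_mul, hs, F.gram_symm]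
  field_simp
  ring

theorem secondFundamentalForm_neg (htr : F.traceSecond x n < 0) (hdet : 0 < F.detSecond x n)
    {v : TangentSpace 𝓘(ℝ, E2) x} (hv : v ≠ 0) : F.secondFundamentalForm x n v v < 0 := by
  obtain ⟨a, b, rfl⟩ := eq_coord_comb x v
  have hab : a ≠ 0 ∨ b ≠ 0 := by
    by_contra! h
    exact hv (by simp [h.1, h.2])
  rw [secondFundamentalForm_coord_comb hn]
  rw [detSecond_eq hn] at hdet
  have h := mul_neg_of_pos_of_neg (F.gram_det_pos x) htr
  rw [det_mul_traceSecond hn] at h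
  exact quadratic_neg_of_trace_neg_of_det_pos (F.gram_zero_zero_pos x) (F.gram_one_one_pos x)
    (F.gram_det_pos x) h hdet hab

/-- The vanishing of the determinant is recorded too: it decides which null direction `G` has in the
marginal case. -/
theorem secondFundamentalForm_eq_zero (htr : F.traceSecond x n = 0) (hdet : 0 ≤ F.detSecond x n) :
    F.detSecond x n = 0 ∧ ∀ v, F.secondFundamentalForm x n v v = 0 := by
  rw [detSecond_eq hn] at hdet ⊢
  have h := det_mul_traceSecond hn
  rw [htr, mul_zero] at h
  obtain ⟨h1, h2, h3⟩ := quadratic_eq_zero_of_trace_eq_zero (F.gram_zero_zero_pos x)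
    (F.gram_one_one_pos x) (F.gram_det_pos x) h.symm hdet
  refine ⟨by simp [h1, h2], fun v => ?_⟩
  obtain ⟨a, b, rfl⟩ := eq_coord_comb x v
  rw [secondFundamentalForm_coord_comb hn, h1, h2, h3]
  ring

end Coordinates

/-! ### Causal character of the shape tensor and of loops -/

theorem isFutureTimelike_shape (hF : F.IsTotallyFutureTrapped) {v : TangentSpace 𝓘(ℝ, E2) x}
    (hv : v ≠ 0) : G.IsFutureTimelike (F.shape x v v) := by
  obtain ⟨l, k, h, hG⟩ := hF.2 x
  have hH := hF.1 x
  rw [h.meanCurvature_eq_comb, h.isFutureTimelike_iff] at hH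
  rw [detVector, h.isPastTimelike_iff] at hG
  rw [h.shape_eq_comb, h.isFutureTimelike_iff]
  exact ⟨secondFundamentalForm_neg h.right_mem hH.1 hG.1 hv,
    secondFundamentalForm_neg h.left_mem hH.2 hG.2 hv⟩

theorem isFutureNull_shape (hF : F.IsTotallyMarginallyFutureTrapped)
    {v : TangentSpace 𝓘(ℝ, E2) x} (hv : v ≠ 0) :
    G.IsFutureNull (F.shape x v v) ∧
      ∃ a : ℝ, a ≠ 0 ∧ F.shape x v v = a • F.meanCurvature x := by
  obtain ⟨l, k, h, hG⟩ := hF.2 x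
  have hH := hF.1 x
  rw [h.meanCurvature_eq_comb, h.isFutureNull_iff] at hH
  have hG' := h.of_isPastNull hG
  rw [h.shape_eq_comb, h.isFutureNull_iff, h.meanCurvature_eq_comb]
  -- Here `m` is the null normal with vanishing trace, which may be either `k` or `l`; the statement
  -- treats both cases.
  have key : ∀ {m n : TangentSpace 𝓘(ℝ, E4) (F.emb x)}, m ∈ F.normal x → n ∈ F.normal x →
      F.traceSecond x m = 0 → F.traceSecond x n < 0 →
      (F.detSecond x m = 0 ∧ 0 < F.detSecond x n ∨ F.detSecond x n = 0 ∧ 0 < F.detSecond x m) →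
      F.secondFundamentalForm x m v v = 0 ∧ F.secondFundamentalForm x n v v < 0 := by
    intro m n hm hn htm htn hd
    have h1 : 0 ≤ F.detSecond x m := hd.elim (fun h => h.1.ge) (fun h => h.2.le)
    obtain ⟨h2, h3⟩ := secondFundamentalForm_eq_zero hm htm h1
    -- The alternative `det K_m > 0` is excluded because `K_m` vanishes.
    have h4 : 0 < F.detSecond x n := hd.elim (fun h => h.2) (fun h => absurd h2 h.2.ne')
    exact ⟨h3 v, secondFundamentalForm_neg hn htn h4 hv⟩
  rcases hH with ⟨h1, h2⟩ | ⟨h1, h2⟩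
  · obtain ⟨h3, h4⟩ := key h.right_mem h.left_mem h1 h2 hG'
    -- Both `K(v, v)` and `H` are multiples of `k` here; the witness is the ratio of their
    -- coefficients.
    refine ⟨Or.inl ⟨h3, h4⟩, F.secondFundamentalForm x l v v / F.traceSecond x l,
      div_ne_zero h4.ne h2.ne, ?_⟩
    rw [h3, h1, neg_zero, zero_smul, zero_sub, zero_sub, smul_neg, smul_smul,
      div_mul_cancel₀ _ h2.ne]
  · obtain ⟨h3, h4⟩ := key h.left_mem h.right_mem h1 h2 hG'.symm
    refine ⟨Or.inr ⟨h3, h4⟩, F.secondFundamentalForm x k v v / F.traceSecond x k,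
      div_ne_zero h4.ne h2.ne, ?_⟩
    rw [h3, h1, zero_smul, sub_zero, sub_zero, smul_smul, mul_neg, div_mul_cancel₀ _ h2.ne]

end SpacelikeSurface

theorem ClosedLoop.unitTangent_ne_zero (C : ClosedLoop S) (F : SpacelikeSurface G S) (t : ℝ) :
    C.unitTangent F t ≠ 0 :=
  smul_ne_zero (inv_ne_zero (C.speed_pos F t).ne') (C.regular t)

theorem ClosedLoop.isCollinearWithMeanCurvature {F : SpacelikeSurface G S}
    (hF : F.IsTotallyMarginallyFutureTrapped) (C : ClosedLoop S) :
    C.IsCollinearWithMeanCurvature F := fun t => by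
  rw [C.outwardCurvature_eq_shape]
  exact (SpacelikeSurface.isFutureNull_shape hF (C.unitTangent_ne_zero F t)).2

theorem ClosedLoop.consistentAt {F : SpacelikeSurface G S}
    (hF : F.IsTotallyMarginallyFutureTrapped) (C C' : ClosedLoop S) (x : S) :
    C.ConsistentAt F C' x := by
  rintro t t' rfl h
  obtain ⟨a, ha, h1⟩ := ClosedLoop.isCollinearWithMeanCurvature hF C t
  obtain ⟨b, hb, h2⟩ := ClosedLoop.isCollinearWithMeanCurvature hF C' t'
  -- The two mean curvature vectors lie over points that are only provably equal, so they are
  -- compared in the model space with the point generalized.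
  have key : ∀ y : S, y = C.curve t →
      (F.meanCurvature y : E4) = (F.meanCurvature (C.curve t) : E4) := by
    rintro _ rfl
    rfl
  have h3 : (C.outwardCurvature F t : E4) = a • (F.meanCurvature (C.curve t) : E4) := h1
  have h4 : (C'.outwardCurvature F t' : E4) = b • (F.meanCurvature (C'.curve t') : E4) := h2
  refine ⟨b / a, div_ne_zero hb ha, ?_⟩
  rw [h3, h4, key _ h]
  exact (congrArg (· • (F.meanCurvature (C.curve t) : E4)) (div_mul_cancel₀ b ha).symm).trans
    (mul_smul _ _ _)

end TrappedHoop

end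

open TrappedHoop in
theorem proposition2
    {V : Type*} [TopologicalSpace V] [ChartedSpace E4 V] [IsManifold 𝓘(ℝ, E4) ∞ V]
    (G : Spacetime V)
    {S : Type*} [TopologicalSpace S] [ChartedSpace E2 S] [IsManifold 𝓘(ℝ, E2) ∞ S]
    [CompactSpace S] [ConnectedSpace S]
    (F : SpacelikeSurface G S) :
    (F.IsTotallyFutureTrapped →
      ∀ (x : S) (C : ClosedLoop S), C.PassesThrough x → C.IsOutwardlyFutureTrapped F) ∧
    (F.IsTotallyMarginallyFutureTrapped →
      ∀ (x : S) (C : ClosedLoop S), C.PassesThrough x →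
        C.IsOutwardlyMarginallyFutureTrapped F ∧
        C.IsCollinearWithMeanCurvature F ∧
        ∀ C' : ClosedLoop S, C'.PassesThrough x → C.ConsistentAt F C' x) := by
  refine ⟨fun hF x C _ t => ?_, fun hF x C _ => ⟨fun t => ?_,
    C.isCollinearWithMeanCurvature hF, fun C' _ => C.consistentAt hF C' x⟩⟩
  · rw [C.outwardCurvature_eq_shape]
    exact SpacelikeSurface.isFutureTimelike_shape hF (C.unitTangent_ne_zero F t)
  · rw [C.outwardCurvature_eq_shape]
    exact (SpacelikeSurface.isFutureNull_shape hF (C.unitTangent_ne_zero F t)).1
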